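/- Let $k$ be an algebraically closed field, $R$ a finite dimensional $k$-algebra, and $\mathrm{mod}\,R$ the category of finitely generated left $R$-modules; all modules below are finitely generated left $R$-modules. **Notation.** $\mathrm{pd}\,M\in\mathbb N\cup\{\infty\}$ is the projective dimension of $M$, with $\mathrm{pd}\,0=0$. For a class $\mathcal C$ of modules, $\mathrm{pfd}\,\mathcal C:=\sup\{\mathrm{pd}\,C : C\in\mathcal C,\ \mathrm{pd}\,C<\infty\}$. $\Omega M$ is the kernel of the projective cover of $M$, and $\Omega^n$ is its $n$-th iterate. A *stratifying system* $(\theta,\le)$ of size $t\geq 1$ is a family of indecomposable modules $\theta(1),\dots,\theta(t)$ with $\mathrm{Hom}_R(\theta(j),\theta(i))=0$ for $j>i$ and $\mathrm{Ext}^1_R(\theta(j),\theta(i))=0$ for $j\ge i$. $\mathcal F(\theta)$ is the class of modules $M$ having a finite chain of submodules $0=M_0\subseteq M_1\subseteq\cdots\subseteq M_m=M$ with each $M_l/M_{l-1}$ isomorphic to some $\theta(i)$ (the case $m=0$ being $M=0$), and $\mathcal P(\theta)$ is the class of modules $X$ with $\mathrm{Ext}^1_R(X,Y)=0$ for all $Y\in\mathcal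 F(\theta)$. An *Ext-projective cover* of $M\in\mathcal F(\theta)$ in $\mathcal F(\theta)$ is a homomorphism $f:Q\to M$ with $Q\in\mathcal F(\theta)\cap\mathcal P(\theta)$ and $\mathrm{Ker}\,f\in\mathcal F(\theta)$ such that every homomorphism $X\to M$ with $X\in\mathcal P(\theta)$ factors through $f$, and every endomorphism $g$ of $Q$ with $fg=f$ is an automorphism. *The Igusa–Todorov function.* Let $\mathcal K$ be the abelian group generated by symbols $[M]$, $M\in\mathrm{mod}\,R$, modulo the relations $[C]=[A]+[B]$ if $C\simeq A\oplus B$, and $[P]=0$ if $P$ is projective. The syzygy induces an endomorphism $\Omega$ of $\mathcal K$ with $\Omega[M]=[\Omega M]$. Let $\langle M\rangle\subseteq\mathcal K$ be the subgroup generated by the classes of the indecomposable direct summands of $M$, and let $\Phi(M)$ be the smallest $n\geq 0$ such that $\Omega:\Omega^m\langle M\rangle\to\Omega^{m+1}\langle M\rangle$ is an isomorphism for all $m\ge n$. Then $\Psi(M):=\Phi(M)+\mathrm{pfd}\,\mathcal C_M\in\mathbb N$, where $\mathcal C_M$ is the class of direct summands of $\Omega^{\Phi(M)}(M)$. **Theorem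 4.7.** Let $(\theta,\le)$ be a stratifying system of size $t$ in $\mathrm{mod}\,R$ such that $\{i : \mathrm{pd}\,\theta(i)=\infty\}=\{i_0,i_1\}$ with $i_0<i_1$. Let $s:=\max\{\mathrm{pd}\,\theta(j) : j\ne i_0,i_1\}$ if $t>2$, and $s:=0$ if $t=2$. Then an Ext-projective cover $Q\to\bigoplus_{i=1}^t\theta(i)$ in $\mathcal F(\theta)$ exists, and for every such cover $$\mathrm{pfd}\,\mathcal F(\theta)\le s+2+\min(\alpha,\beta),$$ where $\alpha:=\Psi\big(\Omega^{s+1}\theta(i_1)\oplus\Omega^{s+2}\theta(i_0)\big)$ and $\beta:=\Psi\big(\Omega^{s+1}(Q\oplus\theta(i_1))\big)$. -/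

import Mathlib

open CategoryTheory

universe u

namespace StratSys

/-! ### Modules: indecomposability, direct summands, projective dimension -/

section Basic

variable {R : Type u} [Ring R]

/-- A nonzero module that is not the direct sum of two nonzero submodules. -/
def IsIndecomposable (M : FGModuleCat.{u} R) : Prop :=
  Nontrivial M ∧ ∀ A B : Submodule R M, IsCompl A B → A = ⊥ ∨ B = ⊥

/-- `X` is (isomorphic to) a direct summand of `M`. -/
def IsDirectSummand (X M : FGModuleCat.{u} R) : Prop :=
  ∃ Y : FGModuleCat.{u} R, Nonempty (M ≃ₗ[R] (X × Y))

/-- The projective dimension, an element of `ℕ ∪ {∞}`, with the convention `pd 0 = 0`. -/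
noncomputable def pd (M : FGModuleCat.{u} R) : ℕ∞ :=
  (projectiveDimension M.obj).unbotD 0

/-- The projective finitistic dimension of a class of modules: the supremum of the projective
dimensions of the members of finite projective dimension. -/
noncomputable def pfd (C : FGModuleCat.{u} R → Prop) : ℕ∞ :=
  ⨆ (M : FGModuleCat.{u} R) (_ : C M ∧ pd M < ⊤), pd M

/-- `Ext¹_R(X, Y) = 0`. -/
def ExtOneVanishes (X Y : FGModuleCat.{u} R) : Prop :=
  Subsingleton (Abelian.Ext.{u} X.obj Y.obj 1)

/-- The class `F(C)` of `C`-filtered modules: there is a chain `0 = M₀ ⊆ M₁ ⊆ ⋯ ⊆ Mₘ = M` of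
submodules such that each `Mᵢ₊₁ / Mᵢ` is isomorphic to a member of `C`
(`m = 0` gives the zero module). -/
def IsFiltered (C : FGModuleCat.{u} R → Prop) (M : FGModuleCat.{u} R) : Prop :=
  ∃ (m : ℕ) (c : ℕ → Submodule R M), Monotone c ∧ c 0 = ⊥ ∧ c m = ⊤ ∧
    ∀ i < m, ∃ X : FGModuleCat.{u} R, C X ∧
      Nonempty ((c (i + 1) ⧸ (c i).submoduleOf (c (i + 1))) ≃ₗ[R] X)

end Basic

/-! ### Stratifying systems and Ext-projective covers -/

section Stratifying

variable {R : Type u} [Ring R] {t : ℕ}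

/-- A stratifying system of size `t`, indexed by `Fin t` with its natural order. -/
structure IsStratifyingSystem (θ : Fin t → FGModuleCat.{u} R) : Prop where
  indecomposable : ∀ i, IsIndecomposable (θ i)
  hom_eq_zero : ∀ i j, i < j → ∀ f : θ j →ₗ[R] θ i, f = 0
  ext_eq_zero : ∀ i j, i ≤ j → ExtOneVanishes (θ j) (θ i)

/-- The class `F(θ)` of `θ`-filtered modules. -/
def Filt (θ : Fin t → FGModuleCat.{u} R) : FGModuleCat.{u} R → Prop :=
  IsFiltered fun X => ∃ i, X = θ i

/-- The class `P(θ)` of modules `X` with `Ext¹_R(X, Y) = 0` for all `Y` in `F(θ)`. -/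
def ExtProj (θ : Fin t → FGModuleCat.{u} R) (X : FGModuleCat.{u} R) : Prop :=
  ∀ Y, Filt θ Y → ExtOneVanishes X Y

/-- `f : Q → M` is an Ext-projective cover of `M` in `F(θ)`: a morphism of `F(θ)` that is a right
minimal right `P(θ)`-approximation of `M` and whose kernel lies in `F(θ)`. -/
structure IsExtProjCover [IsNoetherianRing R] (θ : Fin t → FGModuleCat.{u} R)
    {Q M : FGModuleCat.{u} R} (f : Q →ₗ[R] M) : Prop where
  source_filt : Filt θ Q
  target_filt : Filt θ M
  source_extProj : ExtProj θ Q
  approx : ∀ X : FGModuleCat.{u} R, ExtProj θ X →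
    ∀ g : X →ₗ[R] M, ∃ h : X →ₗ[R] Q, f ∘ₗ h = g
  minimal : ∀ g : Q →ₗ[R] Q, f ∘ₗ g = f → Function.Bijective g
  ker_filt : Filt θ (FGModuleCat.of R (LinearMap.ker f))

end Stratifying

/-! ### Projective covers and syzygies -/

section Syzygy

/-- `f : P → M` is a projective cover: `P` is projective and `f` is an epimorphism with
superfluous kernel. -/
structure IsProjCover {R : Type u} [Ring R] {P M : FGModuleCat.{u} R} (f : P →ₗ[R] M) :
    Prop where
  projective : Module.Projective R P
  surjective : Function.Surjective f
  superfluous : ∀ N : Submodule R P, N ⊔ LinearMap.ker f = ⊤ → N = ⊤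

variable {R : Type u} [Ring R] [IsArtinianRing R]

theorem exists_projCover (M : FGModuleCat.{u} R) :
    ∃ (P : FGModuleCat.{u} R) (f : P →ₗ[R] M), IsProjCover f := by
  -- take a surjection from a projective module of minimal length
  let S : Set ℕ∞ := {l | ∃ (P : FGModuleCat.{u} R) (f : P →ₗ[R] M), Module.Projective R P ∧
    Function.Surjective f ∧ l = Module.length R P}
  have hS : S.Nonempty := by
    obtain ⟨n, f, hf⟩ := Module.Finite.exists_fin' R M
    exact ⟨_, FGModuleCat.of R (Fin n → R), f, by
      change Module.Projective R (Fin n → R); infer_instance, hf, rfl⟩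
  obtain ⟨P, f, hP, hf, hl⟩ := csInf_mem hS
  refine ⟨P, f, hP, hf, fun N hN => ?_⟩
  have hfN : Function.Surjective (f ∘ₗ N.subtype) := by
    intro m
    obtain ⟨p, rfl⟩ := hf m
    obtain ⟨a, ha, b, hb, rfl⟩ := Submodule.mem_sup.1 (hN ▸ Submodule.mem_top : p ∈ N ⊔ _)
    exact ⟨⟨a, ha⟩, by simp [LinearMap.mem_ker.1 hb]⟩
  obtain ⟨g, hg⟩ := Module.projective_lifting_property (f ∘ₗ N.subtype) f hfN
  let h : Module.End R P := N.subtype ∘ₗ g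
  have hfh : f ∘ₗ h = f := hg
  have hfhn : ∀ n : ℕ, f ∘ₗ (h ^ n) = f := by
    intro n
    induction n with
    | zero => rfl
    | succ n ih => rw [pow_succ, Module.End.mul_eq_comp, ← LinearMap.comp_assoc, ih, hfh]
  obtain ⟨n, hn, hn1⟩ :=
    (h.eventually_isCompl_ker_pow_range_pow.and (Filter.eventually_ge_atTop 1)).exists
  let I := LinearMap.range (h ^ n)
  have hIP : Module.Projective R I :=
    Module.Projective.of_split I.subtype (Submodule.projectionOnto I _ hn.symm)
      (by ext x; simp)
  have hIf : Function.Surjective (f ∘ₗ I.subtype) := by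
    intro m
    obtain ⟨p, rfl⟩ := hf m
    exact ⟨⟨(h ^ n) p, p, rfl⟩, by
      simpa using LinearMap.congr_fun (hfhn n) p⟩
  have hle : Module.length R P ≤ Module.length R I := by
    rw [← hl]
    exact csInf_le' ⟨FGModuleCat.of R I, f ∘ₗ I.subtype, hIP, hIf, rfl⟩
  have hItop : I = ⊤ := by
    by_contra hne
    exact absurd hle (not_le.2 (Submodule.length_lt hne))
  have hIN : I ≤ N := by
    rintro _ ⟨p, rfl⟩
    obtain ⟨n, rfl⟩ := Nat.exists_eq_add_of_le' hn1
    rw [pow_succ']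
    exact (g _).2
  exact top_le_iff.1 (hItop ▸ hIN)

/-- The source of the projective cover of `M`. -/
noncomputable def projCover (M : FGModuleCat.{u} R) : FGModuleCat.{u} R :=
  (exists_projCover M).choose

/-- The projective cover of `M` (unique up to isomorphism). -/
noncomputable def projCoverMap (M : FGModuleCat.{u} R) : projCover M →ₗ[R] M :=
  (exists_projCover M).choose_spec.choose

theorem isProjCover_projCoverMap (M : FGModuleCat.{u} R) : IsProjCover (projCoverMap M) :=
  (exists_projCover M).choose_spec.choose_spec

/-- The syzygy `Ω M`, the kernel of the projective cover of `M`. -/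
noncomputable def syzygy (M : FGModuleCat.{u} R) : FGModuleCat.{u} R :=
  FGModuleCat.of R (LinearMap.ker (projCoverMap M))

end Syzygy

/-! ### The Igusa-Todorov function -/

section IgusaTodorov

variable (R : Type u) [Ring R]

/-- The relations `[C] = [A] + [B]` for `C ≃ A ⊕ B`, and `[P] = 0` for `P` projective. -/
inductive KRel : FreeAbelianGroup (FGModuleCat.{u} R) → Prop
  | sum (A B C : FGModuleCat.{u} R) (e : C ≃ₗ[R] (A × B)) :
      KRel (FreeAbelianGroup.of C - (FreeAbelianGroup.of A + FreeAbelianGroup.of B))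
  | proj (P : FGModuleCat.{u} R) (h : Module.Projective R P) : KRel (FreeAbelianGroup.of P)

/-- The group `K`: the free abelian group on all finitely generated modules modulo the
relations above. -/
abbrev KGroup : Type (u + 1) :=
  FreeAbelianGroup (FGModuleCat.{u} R) ⧸ AddSubgroup.closure {x | KRel R x}

variable {R}

/-- The class `[M]` in `K`. -/
def kClass (M : FGModuleCat.{u} R) : KGroup R :=
  QuotientAddGroup.mk (FreeAbelianGroup.of M)

theorem kClass_sum {A B C : FGModuleCat.{u} R} (e : C ≃ₗ[R] (A × B)) :
    kClass C = kClass A + kClass B := by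
  have h : (QuotientAddGroup.mk
      (FreeAbelianGroup.of C - (FreeAbelianGroup.of A + FreeAbelianGroup.of B)) : KGroup R) = 0 :=
    (QuotientAddGroup.eq_zero_iff _).2 (AddSubgroup.subset_closure (KRel.sum A B C e))
  exact sub_eq_zero.1 h

theorem kClass_proj (P : FGModuleCat.{u} R) (h : Module.Projective R P) : kClass P = 0 :=
  (QuotientAddGroup.eq_zero_iff _).2 (AddSubgroup.subset_closure (KRel.proj P h))

/-- Schanuel's lemma in `K`. -/
theorem kClass_ker_eq [IsNoetherianRing R] {P P' M M' : FGModuleCat.{u} R}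
    (hP : Module.Projective R P) (hP' : Module.Projective R P') (e : M ≃ₗ[R] M')
    (f : P →ₗ[R] M) (f' : P' →ₗ[R] M')
    (hf : Function.Surjective f) (hf' : Function.Surjective f') :
    kClass (FGModuleCat.of R (LinearMap.ker f)) =
      kClass (FGModuleCat.of R (LinearMap.ker f')) := by
  let φ : (P × P') →ₗ[R] M' := (e.toLinearMap ∘ₗ f).coprod (-f')
  let X := FGModuleCat.of R (LinearMap.ker φ)
  have hX : ∀ x : X, e (f x.1.1) = f' x.1.2 := fun x => by
    have h0 : e (f x.1.1) + -(f' x.1.2) = 0 := LinearMap.mem_ker.1 x.2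
    exact add_neg_eq_zero.1 h0
  -- the fibre product splits over both projective modules
  have h1 : kClass X = kClass (FGModuleCat.of R (LinearMap.ker f)) + kClass P' := by
    let p : X →ₗ[R] P' := LinearMap.snd R P P' ∘ₗ (LinearMap.ker φ).subtype
    have hp : Function.Surjective p := fun y => by
      obtain ⟨x, hx⟩ := hf (e.symm (f' y))
      exact ⟨⟨(x, y), by simp [φ, hx]⟩, rfl⟩
    obtain ⟨s, hs⟩ := Module.projective_lifting_property p LinearMap.id hp
    have hs' : ∀ y, (s y).1.2 = y := fun y => LinearMap.congr_fun hs y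
    refine kClass_sum (LinearEquiv.ofBijective
      (LinearMap.prod (LinearMap.codRestrict (LinearMap.ker f)
        (LinearMap.fst R P P' ∘ₗ (LinearMap.ker φ).subtype ∘ₗ (LinearMap.id - s ∘ₗ p))
        fun x => ?_) p) ⟨?_, ?_⟩)
    · have a := hX (x - s (p x))
      have b : (x - s (p x)).1.2 = 0 := by
        change (p x : P') - (s (p x)).1.2 = 0
        rw [hs', sub_self]
      rw [b, map_zero, e.map_eq_zero_iff] at a
      exact a
    · rw [← LinearMap.ker_eq_bot, LinearMap.ker_eq_bot']
      intro x hx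
      have h2 : p x = 0 := congrArg Prod.snd hx
      have h3 : (x - s (p x)).1.1 = 0 := congrArg Subtype.val (congrArg Prod.fst hx)
      rw [h2, map_zero, sub_zero] at h3
      exact Subtype.ext (Prod.ext h3 h2)
    · rintro ⟨⟨x, hx⟩, y⟩
      have hx' : f x = 0 := hx
      have hz : ((x, 0) : P × P') ∈ LinearMap.ker φ := by simp [φ, hx']
      refine ⟨⟨(x, 0), hz⟩ + s y, ?_⟩
      have hpz : p (⟨(x, 0), hz⟩ + s y) = y := by
        rw [map_add]
        change (0 : P') + (s y).1.2 = y
        rw [hs', zero_add]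
      refine Prod.ext (Subtype.ext ?_) hpz
      change ((⟨(x, 0), hz⟩ + s y : X) - s (p (⟨(x, 0), hz⟩ + s y))).1.1 = x
      rw [hpz, add_sub_cancel_right]
  have h2 : kClass X = kClass (FGModuleCat.of R (LinearMap.ker f')) + kClass P := by
    let p : X →ₗ[R] P := LinearMap.fst R P P' ∘ₗ (LinearMap.ker φ).subtype
    have hp : Function.Surjective p := fun x => by
      obtain ⟨y, hy⟩ := hf' (e (f x))
      exact ⟨⟨(x, y), by simp [φ, hy]⟩, rfl⟩
    obtain ⟨s, hs⟩ := Module.projective_lifting_property p LinearMap.id hp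
    have hs' : ∀ y, (s y).1.1 = y := fun y => LinearMap.congr_fun hs y
    refine kClass_sum (LinearEquiv.ofBijective
      (LinearMap.prod (LinearMap.codRestrict (LinearMap.ker f')
        (LinearMap.snd R P P' ∘ₗ (LinearMap.ker φ).subtype ∘ₗ (LinearMap.id - s ∘ₗ p))
        fun x => ?_) p) ⟨?_, ?_⟩)
    · have a := hX (x - s (p x))
      have b : (x - s (p x)).1.1 = 0 := by
        change (p x : P) - (s (p x)).1.1 = 0
        rw [hs', sub_self]
      rw [b, map_zero, map_zero] at a
      exact a.symm
    · rw [← LinearMap.ker_eq_bot, LinearMap.ker_eq_bot']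
      intro x hx
      have h2 : p x = 0 := congrArg Prod.snd hx
      have h3 : (x - s (p x)).1.2 = 0 := congrArg Subtype.val (congrArg Prod.fst hx)
      rw [h2, map_zero, sub_zero] at h3
      exact Subtype.ext (Prod.ext h2 h3)
    · rintro ⟨⟨y, hy⟩, x⟩
      have hy' : f' y = 0 := hy
      have hz : ((0, y) : P × P') ∈ LinearMap.ker φ := by simp [φ, hy']
      refine ⟨⟨(0, y), hz⟩ + s x, ?_⟩
      have hpz : p (⟨(0, y), hz⟩ + s x) = x := by
        rw [map_add]
        change (0 : P) + (s x).1.1 = x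
        rw [hs', zero_add]
      refine Prod.ext (Subtype.ext ?_) hpz
      change ((⟨(0, y), hz⟩ + s x : X) - s (p (⟨(0, y), hz⟩ + s x))).1.2 = y
      rw [hpz, add_sub_cancel_right]
  rw [kClass_proj P' hP', add_zero] at h1
  rw [kClass_proj P hP, add_zero] at h2
  rw [← h1, h2]

variable [IsArtinianRing R]

theorem kClass_syzygy_proj (P : FGModuleCat.{u} R) (hP : Module.Projective R P) :
    kClass (syzygy P) = 0 := by
  have hc := isProjCover_projCoverMap P
  have h := kClass_ker_eq hc.projective hP (LinearEquiv.refl R P) (projCoverMap P)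
    LinearMap.id hc.surjective Function.surjective_id
  refine h.trans (kClass_proj _ ?_)
  rw [LinearMap.ker_id]
  change Module.Projective R (⊥ : Submodule R P)
  infer_instance

theorem kClass_syzygy_sum {A B C : FGModuleCat.{u} R} (e : C ≃ₗ[R] (A × B)) :
    kClass (syzygy C) = kClass (syzygy A) + kClass (syzygy B) := by
  have hA := isProjCover_projCoverMap A
  have hB := isProjCover_projCoverMap B
  have hC := isProjCover_projCoverMap C
  have pA := hA.projective
  have pB := hB.projective
  have hAB : Module.Projective R (projCover A × projCover B) := inferInstance
  have h := kClass_ker_eq (P' := FGModuleCat.of R (projCover A × projCover B))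
    (M' := FGModuleCat.of R (A × B)) hC.projective hAB e (projCoverMap C)
    ((projCoverMap A).prodMap (projCoverMap B)) hC.surjective
    (hA.surjective.prodMap hB.surjective)
  refine h.trans (kClass_sum ?_)
  exact
    { toFun := fun x => (⟨x.1.1, congrArg Prod.fst x.2⟩, ⟨x.1.2, congrArg Prod.snd x.2⟩)
      invFun := fun y => ⟨(y.1.1, y.2.1), Prod.ext y.1.2 y.2.2⟩
      map_add' := fun _ _ => rfl
      map_smul' := fun _ _ => rfl
      left_inv := fun _ => rfl
      right_inv := fun _ => rfl }

variable (R) in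
/-- The endomorphism `Ω` of `K` with `Ω [M] = [Ω M]`. -/
noncomputable def kOmega : KGroup R →+ KGroup R :=
  QuotientAddGroup.lift _ (FreeAbelianGroup.lift fun M => kClass (syzygy M)) <| by
    rw [AddSubgroup.closure_le]
    rintro x (⟨A, B, C, e⟩ | ⟨P, hP⟩)
    · simp [kClass_syzygy_sum e]
    · simp [kClass_syzygy_proj P hP]

theorem kOmega_kClass (M : FGModuleCat.{u} R) : kOmega R (kClass M) = kClass (syzygy M) := by
  simp [kOmega, kClass]

/-- The subgroup `⟨M⟩` of `K` generated by the indecomposable direct summands of `M`. -/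
def kSpan (M : FGModuleCat.{u} R) : AddSubgroup (KGroup R) :=
  AddSubgroup.closure {x | ∃ X, IsIndecomposable X ∧ IsDirectSummand X M ∧ x = kClass X}

/-- The subgroup `Ω^m ⟨M⟩` of `K`. -/
noncomputable def kSpanIter (M : FGModuleCat.{u} R) (m : ℕ) : AddSubgroup (KGroup R) :=
  (AddSubgroup.map (kOmega R))^[m] (kSpan M)

/-- `Φ(M)`: the smallest `n` such that `Ω : Ω^m ⟨M⟩ → Ω^(m+1) ⟨M⟩` is an isomorphism for all
`m ≥ n`. -/
noncomputable def igusaTodorovPhi (M : FGModuleCat.{u} R) : ℕ :=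
  sInf {n | ∀ m, n ≤ m → Set.BijOn (kOmega R) (kSpanIter M m) (kSpanIter M (m + 1))}

/-- `Ψ(M) = Φ(M) + pfd C_M`, where `C_M` is the class of direct summands of `Ω^Φ(M) M`. As
`C_M` has only finitely many members up to isomorphism, `pfd C_M` is a natural number. -/
noncomputable def igusaTodorovPsi (M : FGModuleCat.{u} R) : ℕ :=
  igusaTodorovPhi M +
    (pfd fun X => IsDirectSummand X (syzygy^[igusaTodorovPhi M] M)).toNat

end IgusaTodorov

end StratSys

open StratSys

/-! Write `a` for `i₀` and `b` for `i₁`, and take `M` filtered of finite projective dimension. Since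
`Ext¹(θ j, θ i) = 0` for `i ≤ j`, factors of large index can be moved to the bottom of a filtration
(`FiltOn.exists_split`). Cutting just below `a` gives `N ⊆ M` with `M/N` of projective dimension at
most `s`; cutting just above `a` gives `X ⊆ N` with `X` filtered by indices `> a` and `N/X = T` a
direct sum of copies of `θ a`. Up to projective summands, `Ω^(s+1)` does not see factors of
projective dimension at most `s`: thus `Ω^(s+1) M` agrees with `Ω^(s+1) N`, and `Ω^(s+1) X` is a sum
of summands of `Ω^(s+1) (θ b)`.

Now resolve `N`. Lifting the projective cover of `T` gives `0 → ΩT → X ⊕ P → N → 0`. Lifting instead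
a sum `Q'` of copies of the minimal Ext-projective approximation of `θ a` gives `0 → K → X ⊕ Q' → N
→ 0`, with `K` filtered by indices `> a`; that approximation is a summand of `Q`. After `Ω^(s+1)`,
the Igusa-Todorov inequality (`SES.pd_le_psi`) bounds the projective dimension of `Ω^(s+1) N` by `α
+ 1` and by `β + 1`, which gives `s + 2 + α` and `s + 2 + β` for `M` (`pd_le_of_filt`).

The Igusa-Todorov inequality rests on two facts. Equality in `K` is stable isomorphism, by
Krull-Schmidt cancellation (`kClass_eq_iff`). If the first two terms of a short exact sequence are
stably isomorphic, Fitting's lemma finds a summand of the first term that controls the third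
(`SES.exists_retract_pd`). Approximations are built by universal extensions; a minimal one is
obtained by minimizing length, which uses that filtered modules are closed under direct summands
(`FiltOn.of_isRetract`). -/

namespace StratSys

/-! ### Short exact sequences, vanishing of `Ext¹`, and retracts. -/

section ShortExactSequences

variable {R : Type u} [Ring R]

/-- A short exact sequence `0 → A → B → C → 0` of finitely generated modules. -/
structure IsSES {A B C : FGModuleCat.{u} R} (f : A →ₗ[R] B) (g : B →ₗ[R] C) : Prop where
  inj : Function.Injective f
  exact : Function.Exact f g
  surj : Function.Surjective g

/-- There is a short exact sequence `0 → A → B → C → 0`. -/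
def SES (A B C : FGModuleCat.{u} R) : Prop :=
  ∃ (f : A →ₗ[R] B) (g : B →ₗ[R] C), IsSES f g

/-- The short complex of modules underlying a short exact sequence. -/
def IsSES.complex {A B C : FGModuleCat.{u} R} {f : A →ₗ[R] B} {g : B →ₗ[R] C} (h : IsSES f g) :
    ShortComplex (ModuleCat.{u} R) :=
  ShortComplex.mk (X₁ := A.obj) (X₂ := B.obj) (X₃ := C.obj) (ModuleCat.ofHom f)
    (ModuleCat.ofHom g) (by ext x; exact h.exact.apply_apply_eq_zero x)

theorem IsSES.shortExact {A B C : FGModuleCat.{u} R} {f : A →ₗ[R] B} {g : B →ₗ[R] C}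
    (h : IsSES f g) : h.complex.ShortExact where
  exact := (ShortComplex.ShortExact.moduleCat_exact_iff_function_exact _).2 h.exact
  mono_f := (ModuleCat.mono_iff_injective _).2 h.inj
  epi_g := (ModuleCat.epi_iff_surjective _).2 h.surj

theorem isSES_ker [IsNoetherianRing R] {B C : FGModuleCat.{u} R} {g : B →ₗ[R] C}
    (hg : Function.Surjective g) :
    IsSES (A := FGModuleCat.of R (LinearMap.ker g)) (LinearMap.ker g).subtype g where
  inj := Subtype.val_injective
  exact := LinearMap.exact_subtype_ker_map g
  surj := hg

theorem isSES_submodule [IsNoetherianRing R] {B : FGModuleCat.{u} R} (N : Submodule R B) :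
    IsSES (A := FGModuleCat.of R N) (C := FGModuleCat.of R (B ⧸ N)) N.subtype N.mkQ where
  inj := Subtype.val_injective
  exact := LinearMap.exact_subtype_mkQ N
  surj := N.mkQ_surjective

theorem isSES_prod (A B : FGModuleCat.{u} R) :
    IsSES (B := FGModuleCat.of R (A × B)) (LinearMap.inl R A B) (LinearMap.snd R A B) where
  inj := LinearMap.inl_injective
  exact := .inl_snd
  surj := LinearMap.snd_surjective

theorem extOneVanishes_of_eq_zero {X Y : FGModuleCat.{u} R}
    (h : ∀ x : Abelian.Ext.{u} X.obj Y.obj 1, x = 0) : ExtOneVanishes X Y :=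
  ⟨fun a b => by rw [h a, h b]⟩

theorem ExtOneVanishes.eq_zero {X Y : FGModuleCat.{u} R} (h : ExtOneVanishes X Y)
    (x : Abelian.Ext.{u} X.obj Y.obj 1) : x = 0 :=
  Subsingleton.elim (h := h) _ _

section

variable {A B C : FGModuleCat.{u} R} {f : A →ₗ[R] B} {g : B →ₗ[R] C}

theorem IsSES.exists_lift (h : IsSES f g) {X : FGModuleCat.{u} R} (hX : ExtOneVanishes X A)
    (u : X →ₗ[R] C) : ∃ v : X →ₗ[R] B, g ∘ₗ v = u := by
  obtain ⟨x, hx⟩ := Abelian.Ext.covariant_sequence_exact₃ X.obj h.shortExact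
    (Abelian.Ext.mk₀ (ModuleCat.ofHom u : X.obj ⟶ C.obj)) (zero_add 1) (hX.eq_zero _)
  obtain ⟨v, rfl⟩ := (Abelian.Ext.mk₀_bijective _ _).2 x
  rw [Abelian.Ext.mk₀_comp_mk₀] at hx
  exact ⟨v.hom, congrArg ModuleCat.Hom.hom ((Abelian.Ext.mk₀_bijective _ _).1 hx)⟩

theorem projective_obj (P : FGModuleCat.{u} R) [Module.Projective R P] : Projective P.obj :=
  (IsProjective.iff_projective (R := R) P).1 inferInstance

theorem extOneVanishes_of_projective {X Y : FGModuleCat.{u} R} (hX : Module.Projective R X) :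
    ExtOneVanishes X Y := by
  have := projective_obj X
  exact projective_iff_subsingleton_ext_one.1 this (Y := Y.obj)

theorem IsSES.extOneVanishes_mid_left (h : IsSES f g) {Y : FGModuleCat.{u} R}
    (hA : ExtOneVanishes A Y) (hC : ExtOneVanishes C Y) : ExtOneVanishes B Y := by
  refine extOneVanishes_of_eq_zero fun x => ?_
  obtain ⟨y, rfl⟩ := Abelian.Ext.contravariant_sequence_exact₂ h.shortExact Y.obj x
    (hA.eq_zero _)
  rw [show y = 0 from hC.eq_zero y, Abelian.Ext.comp_zero]
  rfl

theorem IsSES.extOneVanishes_mid_right (h : IsSES f g) {X : FGModuleCat.{u} R}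
    (hA : ExtOneVanishes X A) (hC : ExtOneVanishes X C) : ExtOneVanishes X B := by
  refine extOneVanishes_of_eq_zero fun x => ?_
  obtain ⟨y, rfl⟩ := Abelian.Ext.covariant_sequence_exact₂ X.obj h.shortExact x
    (hC.eq_zero _)
  rw [show y = 0 from hA.eq_zero y, Abelian.Ext.zero_comp]
  rfl

/-- A class spanned by maps out of `K` kills `Ext¹` after a universal extension. -/
theorem IsSES.extOneVanishes_pushout (h : IsSES f g) {P K M Y : FGModuleCat.{u} R}
    {i : K →ₗ[R] P} {p : P →ₗ[R] M} (h' : IsSES i p) (hP : Module.Projective R P)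
    (a : K →ₗ[R] A) (b : P →ₗ[R] B) (c : M →ₗ[R] C)
    (hab : f ∘ₗ a = b ∘ₗ i) (hbc : g ∘ₗ b = c ∘ₗ p) (hc : Function.Bijective c)
    (hA : ExtOneVanishes A Y) (hY : ∀ u : K →ₗ[R] Y, ∃ v : A →ₗ[R] Y, v ∘ₗ a = u) :
    ExtOneVanishes B Y := by
  refine extOneVanishes_of_eq_zero fun x => ?_
  obtain ⟨y, rfl⟩ := Abelian.Ext.contravariant_sequence_exact₂ h.shortExact Y.obj x
    (hA.eq_zero _)
  let e := LinearEquiv.ofBijective c hc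
  let φ : h'.complex ⟶ h.complex :=
    { τ₁ := ModuleCat.ofHom a
      τ₂ := ModuleCat.ofHom b
      τ₃ := ModuleCat.ofHom c
      comm₁₂ := by ext x; exact LinearMap.congr_fun hab x
      comm₂₃ := by ext x; exact LinearMap.congr_fun hbc x }
  -- Since `Ext¹(P, Y) = 0`, the class of `y` on `M` is the connecting image of a map `w : K → Y`,
  -- and `w` factors through `a` by `hY`.
  obtain ⟨z, hz⟩ := Abelian.Ext.contravariant_sequence_exact₃ h'.shortExact Y.obj
    ((Abelian.Ext.mk₀ φ.τ₃).comp y (zero_add 1))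
    ((extOneVanishes_of_projective hP).eq_zero _) (add_zero 1)
  obtain ⟨w, rfl⟩ := (Abelian.Ext.mk₀_bijective _ _).2 z
  obtain ⟨v, hv⟩ := hY (ModuleCat.Hom.hom w)
  let v' : h.complex.X₁ ⟶ Y.obj := ModuleCat.ofHom v
  have hw : w = φ.τ₁ ≫ v' := by
    ext x
    exact (LinearMap.congr_fun hv x).symm
  let ψ : h.complex.X₃ ⟶ h'.complex.X₃ := ModuleCat.ofHom e.symm.toLinearMap
  have hψ : ψ ≫ φ.τ₃ = 𝟙 _ := by
    ext x
    exact e.apply_symm_apply x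
  have h1 : y = (Abelian.Ext.mk₀ ψ).comp ((Abelian.Ext.mk₀ φ.τ₃).comp y (zero_add 1))
      (zero_add 1) := by
    rw [Abelian.Ext.mk₀_comp_mk₀_assoc, hψ, Abelian.Ext.mk₀_id_comp]
  have h2 : (Abelian.Ext.mk₀ φ.τ₃).comp y (zero_add 1) = (Abelian.Ext.mk₀ φ.τ₃).comp
      (h.shortExact.extClass.comp (Abelian.Ext.mk₀ v')
        (add_zero 1)) (zero_add 1) := by
    rw [← hz, hw, ← Abelian.Ext.mk₀_comp_mk₀,
      ← Abelian.Ext.comp_assoc_of_second_deg_zero,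
      ← Abelian.Ext.comp_assoc_of_third_deg_zero,
      ShortComplex.ShortExact.extClass_naturality h'.shortExact h.shortExact φ]
  -- So `y` is the extension class of `0 → A → B → C → 0` pushed along `v'`, and that class dies
  -- when pulled back to `B`.
  rw [h1, h2, Abelian.Ext.mk₀_comp_mk₀_assoc ψ, hψ, Abelian.Ext.mk₀_id_comp]
  exact h.shortExact.comp_extClass_assoc _ _

end

/-- `X` is a retract of `M`. -/
def IsRetract (X M : FGModuleCat.{u} R) : Prop :=
  ∃ (i : X →ₗ[R] M) (p : M →ₗ[R] X), p ∘ₗ i = LinearMap.id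

theorem IsRetract.refl (X : FGModuleCat.{u} R) : IsRetract X X :=
  ⟨LinearMap.id, LinearMap.id, rfl⟩

theorem IsRetract.trans {X Y Z : FGModuleCat.{u} R} (h : IsRetract X Y) (h' : IsRetract Y Z) :
    IsRetract X Z := by
  obtain ⟨i, p, hp⟩ := h
  obtain ⟨j, q, hq⟩ := h'
  refine ⟨j ∘ₗ i, p ∘ₗ q, LinearMap.ext fun x => ?_⟩
  exact (congrArg p (LinearMap.congr_fun hq (i x))).trans (LinearMap.congr_fun hp x)

theorem isRetract_of_equiv {X Y : FGModuleCat.{u} R} (e : X ≃ₗ[R] Y) : IsRetract X Y :=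
  ⟨e.toLinearMap, e.symm.toLinearMap, by ext x; simp⟩

theorem isRetract_prod_left (X Y : FGModuleCat.{u} R) :
    IsRetract X (FGModuleCat.of R (X × Y)) :=
  ⟨LinearMap.inl R X Y, LinearMap.fst R X Y, rfl⟩

theorem isRetract_prod_right (X Y : FGModuleCat.{u} R) :
    IsRetract Y (FGModuleCat.of R (X × Y)) :=
  ⟨LinearMap.inr R X Y, LinearMap.snd R X Y, rfl⟩

/-- The complement of a retract. -/
theorem exists_equiv_prod_ker [IsNoetherianRing R] {X M : FGModuleCat.{u} R} {i : X →ₗ[R] M}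
    {p : M →ₗ[R] X} (h : p ∘ₗ i = LinearMap.id) :
    Nonempty (M ≃ₗ[R] (X × FGModuleCat.of R (LinearMap.ker p))) := by
  have h' : ∀ x, p (i x) = x := fun x => LinearMap.congr_fun h x
  refine ⟨LinearEquiv.ofBijective (LinearMap.prod p
    (LinearMap.codRestrict (LinearMap.ker p) (LinearMap.id - i ∘ₗ p) fun x => ?_)) ⟨?_, ?_⟩⟩
  · simp [h']
  · rw [← LinearMap.ker_eq_bot, LinearMap.ker_eq_bot']
    intro x hx
    have h1 : p x = 0 := congrArg Prod.fst hx
    have h2 : x - i (p x) = 0 := congrArg Subtype.val (congrArg Prod.snd hx)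
    simpa [h1] using h2
  · rintro ⟨x, y, hy⟩
    have hy' : p y = 0 := hy
    refine ⟨i x + y, Prod.ext ?_ (Subtype.ext ?_)⟩
    · change p (i x + y) = x
      simp [h', hy']
    · change (i x + y) - i (p (i x + y)) = y
      simp [h', hy']

theorem isRetract_iff_isDirectSummand [IsNoetherianRing R] {X M : FGModuleCat.{u} R} :
    IsRetract X M ↔ IsDirectSummand X M := by
  constructor
  · rintro ⟨i, p, h⟩
    exact ⟨_, exists_equiv_prod_ker h⟩
  · rintro ⟨Y, ⟨e⟩⟩
    exact (isRetract_prod_left X Y).trans (isRetract_of_equiv (Y := M) e.symm)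

theorem IsRetract.extOneVanishes_left {X X' Y : FGModuleCat.{u} R} (h : IsRetract X X')
    (hX : ExtOneVanishes X' Y) : ExtOneVanishes X Y := by
  obtain ⟨i, p, hp⟩ := h
  refine extOneVanishes_of_eq_zero fun x => ?_
  have hip : (ModuleCat.ofHom i : X.obj ⟶ X'.obj) ≫ (ModuleCat.ofHom p : X'.obj ⟶ X.obj) =
      𝟙 _ := by
    ext y
    exact LinearMap.congr_fun hp y
  rw [← Abelian.Ext.mk₀_id_comp x, ← hip, ← Abelian.Ext.mk₀_comp_mk₀_assoc, hX.eq_zero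
    ((Abelian.Ext.mk₀ _).comp x (zero_add 1)), Abelian.Ext.comp_zero]

theorem IsRetract.projective {X M : FGModuleCat.{u} R} (h : IsRetract X M)
    (hM : Module.Projective R M) : Module.Projective R X := by
  obtain ⟨i, p, hp⟩ := h
  exact Module.Projective.of_split i p hp

theorem isRetract_of_isUnit {X A : FGModuleCat.{u} R} {i : X →ₗ[R] A} {p : A →ₗ[R] X}
    (h : IsUnit (p ∘ₗ i : Module.End R X)) : IsRetract X A := by
  obtain ⟨v, hv⟩ := h
  refine ⟨i, (↑v⁻¹ : Module.End R X) ∘ₗ p, ?_⟩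
  rw [LinearMap.comp_assoc, ← hv]
  exact v.inv_mul

/-- An isomorphism `A × C ≃ B × C` whose component `C → C` is bijective yields `A ≃ B`. -/
theorem nonempty_equiv_of_bijective {A B C : FGModuleCat.{u} R}
    (φ : (A × C) ≃ₗ[R] (B × C)) (hd : Function.Bijective fun c : C => (φ (0, c)).2) :
    Nonempty (A ≃ₗ[R] B) := by
  let d : C ≃ₗ[R] C := LinearEquiv.ofBijective
    (LinearMap.snd R B C ∘ₗ φ.toLinearMap ∘ₗ LinearMap.inr R A C) hd
  -- Gaussian elimination: the graph of `w` is the kernel of the second component of `φ`, so `φ`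
  -- carries it onto `B × 0`.
  let w : A →ₗ[R] C := -(d.symm.toLinearMap ∘ₗ LinearMap.snd R B C ∘ₗ φ.toLinearMap ∘ₗ
    LinearMap.inl R A C)
  have hd' : ∀ c, d c = (φ (0, c)).2 := fun c => rfl
  have key : ∀ a c, (φ (a, c)).2 = d (c - w a) := by
    intro a c
    have h1 : ((a, c) : A × C) = (a, 0) + (0, c) := by ext <;> simp
    have h2 : d (w a) = -(φ (a, 0)).2 := by
      change d (-(d.symm (φ (a, 0)).2)) = _
      rw [map_neg, LinearEquiv.apply_symm_apply]
    rw [map_sub, h2, h1, map_add, hd']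
    change (φ (a, 0)).2 + (φ (0, c)).2 = _
    abel
  refine ⟨LinearEquiv.ofBijective (LinearMap.fst R B C ∘ₗ φ.toLinearMap ∘ₗ
    LinearMap.prod LinearMap.id w) ⟨?_, ?_⟩⟩
  · rw [← LinearMap.ker_eq_bot, LinearMap.ker_eq_bot']
    intro a ha
    have h1 : (φ (a, w a)).1 = 0 := ha
    have h2 : (φ (a, w a)).2 = 0 := by rw [key, sub_self, map_zero]
    have h3 : φ (a, w a) = 0 := Prod.ext h1 h2
    exact congrArg Prod.fst (φ.map_eq_zero_iff.1 h3)
  · intro b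
    obtain ⟨⟨a, c⟩, hac⟩ := φ.surjective (b, 0)
    have h1 : d (c - w a) = 0 := by rw [← key, hac]
    have h2 : c = w a := sub_eq_zero.1 (d.map_eq_zero_iff.1 h1)
    refine ⟨a, ?_⟩
    change (φ (a, w a)).1 = b
    rw [← h2, hac]

end ShortExactSequences

/-! ### Krull-Schmidt theory: local endomorphism rings, exchange and cancellation. -/

section KrullSchmidt

variable {R : Type u} [Ring R] [IsArtinianRing R]

/-- Fitting's lemma: `M` splits as kernel plus image of a high power of `f`, and one of the two
vanishes. -/
theorem IsIndecomposable.isNilpotent_or_isUnit {M : FGModuleCat.{u} R} (h : IsIndecomposable M)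
    (f : Module.End R M) : IsNilpotent f ∨ IsUnit f := by
  obtain ⟨n, hn, hn1⟩ :=
    (f.eventually_isCompl_ker_pow_range_pow.and (Filter.eventually_ge_atTop 1)).exists
  rcases h.2 _ _ hn with hk | hr
  · right
    have ht : LinearMap.range (f ^ n) = ⊤ := by simpa [hk] using hn.sup_eq_top
    have hu : IsUnit (f ^ n) := (Module.End.isUnit_iff _).2
      ⟨LinearMap.ker_eq_bot.1 hk, LinearMap.range_eq_top.1 ht⟩
    exact (isUnit_pow_iff (by omega)).1 hu
  · exact .inl ⟨n, LinearMap.range_eq_bot.1 hr⟩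

theorem IsIndecomposable.isUnit_or_isUnit {M : FGModuleCat.{u} R} (h : IsIndecomposable M)
    {f g : Module.End R M} (hfg : f + g = 1) : IsUnit f ∨ IsUnit g := by
  rcases h.isNilpotent_or_isUnit f with hf | hf
  · right
    rw [← eq_sub_iff_add_eq'] at hfg
    exact hfg ▸ hf.isUnit_one_sub
  · exact .inl hf

theorem IsIndecomposable.isUnit_of_isUnit_mul {M : FGModuleCat.{u} R} (h : IsIndecomposable M)
    {f g : Module.End R M} (hfg : IsUnit (f * g)) : IsUnit f := by
  rcases h.isNilpotent_or_isUnit f with hf | hf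
  · exfalso
    have hs : Function.Surjective f := by
      intro x
      obtain ⟨y, hy⟩ := ((Module.End.isUnit_iff _).1 hfg).2 x
      exact ⟨g y, hy⟩
    obtain ⟨n, hn⟩ := hf
    have hsn : Function.Surjective (f ^ n) := by
      rw [Module.End.coe_pow]
      exact hs.iterate n
    have := h.1
    obtain ⟨x, hx⟩ := exists_ne (0 : M)
    obtain ⟨y, hy⟩ := hsn x
    rw [hn] at hy
    exact hx hy.symm
  · exact hf

/-- The identity of `X` is the sum of its routes through `A` and through `B`; the endomorphism ring
is local, so one of the routes is invertible. -/
theorem IsIndecomposable.isRetract_or {X A B : FGModuleCat.{u} R} (h : IsIndecomposable X)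
    (hX : IsRetract X (FGModuleCat.of R (A × B))) : IsRetract X A ∨ IsRetract X B := by
  obtain ⟨i, p, hp⟩ := hX
  let i₁ : X →ₗ[R] A := LinearMap.fst R A B ∘ₗ i
  let i₂ : X →ₗ[R] B := LinearMap.snd R A B ∘ₗ i
  let p₁ : A →ₗ[R] X := p ∘ₗ LinearMap.inl R A B
  let p₂ : B →ₗ[R] X := p ∘ₗ LinearMap.inr R A B
  have hsum : (p₁ ∘ₗ i₁ : Module.End R X) + p₂ ∘ₗ i₂ = 1 := by
    refine LinearMap.ext fun x => ?_
    have : p (((i x).1, 0) + (0, (i x).2)) = x := by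
      have e : (((i x).1, 0) + (0, (i x).2) : A × B) = i x := by ext <;> simp
      exact (congrArg p e).trans (LinearMap.congr_fun hp x)
    rw [map_add] at this
    exact this
  exact (h.isUnit_or_isUnit hsum).imp isRetract_of_isUnit isRetract_of_isUnit

theorem IsIndecomposable.nonempty_equiv {X M : FGModuleCat.{u} R} (hX : IsIndecomposable X)
    (hM : IsIndecomposable M) (h : IsRetract X M) : Nonempty (X ≃ₗ[R] M) := by
  obtain ⟨i, p, hp⟩ := h
  have hp' : ∀ x, p (i x) = x := fun x => LinearMap.congr_fun hp x
  have hid : IsIdempotentElem (i ∘ₗ p : Module.End R M) :=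
    LinearMap.ext fun x => congrArg i (hp' (p x))
  rcases hM.isNilpotent_or_isUnit (i ∘ₗ p) with hn | hu
  · exfalso
    obtain ⟨n, hn⟩ := hn
    have h0 : (i ∘ₗ p : Module.End R M) = 0 := by
      rcases n with _ | n
      · have := hM.1
        exact absurd hn one_ne_zero
      · rwa [hid.pow_succ_eq] at hn
    have := hX.1
    obtain ⟨x, hx⟩ := exists_ne (0 : X)
    apply hx
    have h1 : i (p (i x)) = 0 := LinearMap.congr_fun h0 (i x)
    rw [hp'] at h1
    rw [← hp' x, h1, map_zero]
  · refine ⟨(LinearEquiv.ofBijective p ⟨?_, fun x => ⟨i x, hp' x⟩⟩).symm⟩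
    exact Function.Injective.of_comp (f := i) ((Module.End.isUnit_iff _).1 hu).1

/-- Induction on length. It replaces the choice of a decomposition into indecomposables in
everything that follows. -/
theorem fg_induction {P : FGModuleCat.{u} R → Prop}
    (zero : ∀ M : FGModuleCat.{u} R, Subsingleton M → P M)
    (indec : ∀ M, IsIndecomposable M → P M)
    (prod : ∀ A B, P A → P B → P (FGModuleCat.of R (A × B)))
    (equiv : ∀ A B : FGModuleCat.{u} R, (A ≃ₗ[R] B) → P A → P B) (M : FGModuleCat.{u} R) :
    P M := by
  induction hl : Module.length R M using WellFoundedLT.induction generalizing M with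
  | _ l ih =>
    by_cases hM : IsIndecomposable M
    · exact indec M hM
    rcases subsingleton_or_nontrivial M with hs | hn
    · exact zero M hs
    have : ∃ A B : Submodule R M, IsCompl A B ∧ A ≠ ⊥ ∧ B ≠ ⊥ := by
      by_contra hcon
      refine hM ⟨hn, fun A B hAB => ?_⟩
      by_contra hor
      rw [not_or] at hor
      exact hcon ⟨A, B, hAB, hor.1, hor.2⟩
    obtain ⟨A, B, hAB, hA, hB⟩ := this
    have hA' : A ≠ ⊤ := fun h => hB (by simpa [h] using hAB.inf_eq_bot)
    have hB' : B ≠ ⊤ := fun h => hA (by simpa [h] using hAB.inf_eq_bot)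
    exact equiv _ _ (Submodule.prodEquivOfIsCompl A B hAB)
      (prod (FGModuleCat.of R A) (FGModuleCat.of R B)
        (ih _ (hl ▸ Submodule.length_lt hA') _ rfl) (ih _ (hl ▸ Submodule.length_lt hB') _ rfl))

theorem IsIndecomposable.cancel {A B C : FGModuleCat.{u} R} (h : IsIndecomposable C)
    (φ : (A × C) ≃ₗ[R] (B × C)) : Nonempty (A ≃ₗ[R] B) := by
  let d : Module.End R C := LinearMap.snd R B C ∘ₗ φ.toLinearMap ∘ₗ LinearMap.inr R A C
  let c : A →ₗ[R] C := LinearMap.snd R B C ∘ₗ φ.toLinearMap ∘ₗ LinearMap.inl R A C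
  let d' : Module.End R C := LinearMap.snd R A C ∘ₗ φ.symm.toLinearMap ∘ₗ LinearMap.inr R B C
  let b' : C →ₗ[R] A := LinearMap.fst R A C ∘ₗ φ.symm.toLinearMap ∘ₗ LinearMap.inr R B C
  have hφ : ∀ a x, (φ (a, x)).2 = c a + d x := by
    intro a x
    have h1 : ((a, x) : A × C) = (a, 0) + (0, x) := by ext <;> simp
    rw [h1, map_add]
    rfl
  have hsum : (c ∘ₗ b' : Module.End R C) + d * d' = 1 := by
    refine LinearMap.ext fun x => ?_
    exact (hφ _ _).symm.trans (congrArg Prod.snd (φ.apply_symm_apply (0, x)))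
  rcases h.isUnit_or_isUnit hsum with hu | hu
  · obtain ⟨v, hv⟩ := hu
    -- `w` satisfies `c ∘ w = 1 - d`, so precomposing `φ` with the shear `(a, x) ↦ (a + w x, x)`
    -- turns the `C`-component into the identity.
    let w : C →ₗ[R] A := b' ∘ₗ (↑v⁻¹ : Module.End R C) ∘ₗ (1 - d : Module.End R C)
    have hw : ∀ x, c (w x) = x - d x := by
      intro x
      have h1 : (v * v⁻¹ : Module.End R C) (x - d x) = x - d x := by
        rw [v.mul_inv]
        rfl
      rw [hv] at h1
      exact h1
    let σ : (A × C) ≃ₗ[R] (A × C) := LinearEquiv.ofLinearMap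
      (LinearMap.prod (LinearMap.fst R A C + w ∘ₗ LinearMap.snd R A C) (LinearMap.snd R A C))
      (LinearMap.prod (LinearMap.fst R A C - w ∘ₗ LinearMap.snd R A C) (LinearMap.snd R A C))
      (by ext <;> simp) (by ext <;> simp)
    refine nonempty_equiv_of_bijective (σ.trans φ) ?_
    have : (fun x : C => ((σ.trans φ) (0, x)).2) = id := by
      funext x
      change (φ (0 + w x, x)).2 = x
      rw [hφ, zero_add, hw]
      abel
    rw [this]
    exact Function.bijective_id
  · exact nonempty_equiv_of_bijective φ
      ((Module.End.isUnit_iff _).1 (h.isUnit_of_isUnit_mul hu))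

theorem nonempty_equiv_of_prod_equiv (C : FGModuleCat.{u} R) {A B : FGModuleCat.{u} R}
    (φ : (A × C) ≃ₗ[R] (B × C)) : Nonempty (A ≃ₗ[R] B) := by
  induction C using fg_induction generalizing A B with
  | zero C hC =>
    refine nonempty_equiv_of_bijective φ ⟨fun x y _ => Subsingleton.elim x y, fun x => ⟨x, ?_⟩⟩
    exact Subsingleton.elim _ _
  | indec C hC => exact hC.cancel φ
  | prod C D hC hD =>
    obtain ⟨ψ⟩ := hD (A := FGModuleCat.of R (A × C)) (B := FGModuleCat.of R (B × C))
      ((LinearEquiv.prodAssoc R A C D).trans (φ.trans (LinearEquiv.prodAssoc R B C D).symm))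
    exact hC ψ
  | equiv C D e hC =>
    exact hC (((LinearEquiv.refl R A).prodCongr e).trans
      (φ.trans ((LinearEquiv.refl R B).prodCongr e.symm)))

/-- Up to isomorphism, a module has only finitely many indecomposable direct summands. -/
theorem exists_indecomposable_list (M : FGModuleCat.{u} R) :
    ∃ L : List (FGModuleCat.{u} R), ∀ X, IsIndecomposable X → IsRetract X M →
      ∃ Y ∈ L, Nonempty (X ≃ₗ[R] Y) := by
  induction M using fg_induction with
  | zero M hM =>
    refine ⟨[], fun X hX hXM => ?_⟩
    exfalso
    obtain ⟨i, p, hp⟩ := hXM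
    have := hX.1
    obtain ⟨x, hx⟩ := exists_ne (0 : X)
    apply hx
    rw [show x = p (i x) from (LinearMap.congr_fun hp x).symm, Subsingleton.elim (i x) 0, map_zero]
  | indec M hM => exact ⟨[M], fun X hX hXM => ⟨M, by simp, hX.nonempty_equiv hM hXM⟩⟩
  | prod A B hA hB =>
    obtain ⟨L, hL⟩ := hA
    obtain ⟨L', hL'⟩ := hB
    refine ⟨L ++ L', fun X hX hXM => ?_⟩
    rcases hX.isRetract_or hXM with h | h
    · obtain ⟨Y, hY, e⟩ := hL X hX h
      exact ⟨Y, List.mem_append_left _ hY, e⟩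
    · obtain ⟨Y, hY, e⟩ := hL' X hX h
      exact ⟨Y, List.mem_append_right _ hY, e⟩
  | equiv A B e hA =>
    obtain ⟨L, hL⟩ := hA
    exact ⟨L, fun X hX hXB => hL X hX (hXB.trans (isRetract_of_equiv e.symm))⟩

end KrullSchmidt

/-! ### Stable isomorphism and equality in the group `K`. -/

section StableEquivalence

variable {R : Type u} [Ring R]

/-- `A` and `B` are isomorphic up to projective direct summands. -/
def StabEq (A B : FGModuleCat.{u} R) : Prop :=
  ∃ P P' : FGModuleCat.{u} R, Module.Projective R P ∧ Module.Projective R P' ∧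
    Nonempty ((A × P) ≃ₗ[R] (B × P'))

theorem StabEq.of_equiv {A B : FGModuleCat.{u} R} (e : A ≃ₗ[R] B) : StabEq A B := by
  have : Module.Projective R (FGModuleCat.of R PUnit.{u + 1}) := by
    change Module.Projective R PUnit.{u + 1}
    infer_instance
  exact ⟨_, _, this, this, ⟨e.prodCongr (LinearEquiv.refl R _)⟩⟩

theorem StabEq.symm {A B : FGModuleCat.{u} R} (h : StabEq A B) : StabEq B A := by
  obtain ⟨P, P', hP, hP', ⟨e⟩⟩ := h
  exact ⟨P', P, hP', hP, ⟨e.symm⟩⟩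

theorem StabEq.trans {A B C : FGModuleCat.{u} R} (h : StabEq A B) (h' : StabEq B C) :
    StabEq A C := by
  obtain ⟨P, P', hP, hP', ⟨e⟩⟩ := h
  obtain ⟨Q, Q', hQ, hQ', ⟨e'⟩⟩ := h'
  refine ⟨FGModuleCat.of R (P × Q), FGModuleCat.of R (Q' × P'),
    inferInstanceAs (Module.Projective R (P × Q)),
    inferInstanceAs (Module.Projective R (Q' × P')), ⟨?_⟩⟩
  exact (LinearEquiv.prodAssoc R A P Q).symm.trans <|
    (e.prodCongr (LinearEquiv.refl R Q)).trans <|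
    (LinearEquiv.prodAssoc R B P' Q).trans <|
    ((LinearEquiv.refl R B).prodCongr (LinearEquiv.prodComm R P' Q)).trans <|
    (LinearEquiv.prodAssoc R B Q P').symm.trans <|
    (e'.prodCongr (LinearEquiv.refl R P')).trans (LinearEquiv.prodAssoc R C Q' P')

theorem StabEq.prod {A B A' B' : FGModuleCat.{u} R} (h : StabEq A B) (h' : StabEq A' B') :
    StabEq (FGModuleCat.of R (A × A')) (FGModuleCat.of R (B × B')) := by
  obtain ⟨P, P', hP, hP', ⟨e⟩⟩ := h
  obtain ⟨Q, Q', hQ, hQ', ⟨e'⟩⟩ := h'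
  refine ⟨FGModuleCat.of R (P × Q), FGModuleCat.of R (P' × Q'),
    inferInstanceAs (Module.Projective R (P × Q)),
    inferInstanceAs (Module.Projective R (P' × Q')), ⟨?_⟩⟩
  exact (LinearEquiv.prodProdProdComm R A A' P Q).trans <|
    (e.prodCongr e').trans (LinearEquiv.prodProdProdComm R B P' B' Q')

variable (R) in
/-- Stable equivalence of finitely generated modules. -/
def stabSetoid : Setoid (FGModuleCat.{u} R) where
  r := StabEq
  iseqv := ⟨fun _ => .of_equiv (LinearEquiv.refl R _), .symm, .trans⟩

variable (R) in
/-- The monoid of stable isomorphism classes. -/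
def StabClass : Type (u + 1) := Quotient (stabSetoid R)

/-- The stable isomorphism class of a module. -/
def stabClass (M : FGModuleCat.{u} R) : StabClass R := Quotient.mk (stabSetoid R) M

theorem stabClass_eq_iff {A B : FGModuleCat.{u} R} :
    stabClass A = stabClass B ↔ StabEq A B :=
  Quotient.eq (r := stabSetoid R)

instance : Add (StabClass R) where
  add := Quotient.map₂ (sa := stabSetoid R) (sb := stabSetoid R) (sc := stabSetoid R)
    (fun A B => FGModuleCat.of R (A × B)) fun _ _ h _ _ h' => StabEq.prod h h'

theorem StabClass.ind {p : StabClass R → Prop} (h : ∀ M, p (stabClass M)) (x : StabClass R) :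
    p x :=
  Quotient.inductionOn x h

instance : Zero (StabClass R) where
  zero := stabClass (FGModuleCat.of R PUnit.{u + 1})

instance : AddCommMonoid (StabClass R) where
  add_assoc a b c := by
    induction a using StabClass.ind with | _ A
    induction b using StabClass.ind with | _ B
    induction c using StabClass.ind with | _ C
    exact stabClass_eq_iff.2 (.of_equiv (LinearEquiv.prodAssoc R A B C))
  zero_add a := by
    induction a using StabClass.ind with | _ A
    exact stabClass_eq_iff.2 (.of_equiv (LinearEquiv.uniqueProd (R := R) (M := A)))
  add_zero a := by
    induction a using StabClass.ind with | _ A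
    exact stabClass_eq_iff.2 (.of_equiv (LinearEquiv.prodUnique (R := R) (M := A)))
  nsmul := nsmulRec
  add_comm a b := by
    induction a using StabClass.ind with | _ A
    induction b using StabClass.ind with | _ B
    exact stabClass_eq_iff.2 (.of_equiv (LinearEquiv.prodComm R A B))

theorem stabClass_projective {P : FGModuleCat.{u} R} (hP : Module.Projective R P) :
    stabClass P = 0 := by
  refine stabClass_eq_iff.2 ⟨FGModuleCat.of R PUnit.{u + 1}, P, ?_, hP,
    ⟨LinearEquiv.prodComm R _ _⟩⟩
  change Module.Projective R PUnit.{u + 1}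
  infer_instance

theorem kClass_prod (A B : FGModuleCat.{u} R) :
    kClass (FGModuleCat.of R (A × B)) = kClass A + kClass B :=
  kClass_sum (C := FGModuleCat.of R (A × B)) (LinearEquiv.refl R _)

theorem kClass_congr {A B : FGModuleCat.{u} R} (e : A ≃ₗ[R] B) : kClass A = kClass B := by
  let Z : FGModuleCat.{u} R := FGModuleCat.of R PUnit.{u + 1}
  have hZ : Module.Projective R Z := by
    change Module.Projective R PUnit.{u + 1}
    infer_instance
  rw [kClass_sum (A := B) (B := Z) (e.trans (LinearEquiv.prodUnique (R := R) (M := B)).symm),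
    kClass_proj Z hZ, add_zero]

variable [IsArtinianRing R]

/-- Cancellation of modules passes to stable classes because the projective summands can be grouped
with `A` and `B`. It makes the monoid embed in its Grothendieck group. -/
instance : IsCancelAdd (StabClass R) :=
  have : IsRightCancelAdd (StabClass R) := ⟨fun c a b h => by
    induction a using StabClass.ind with | _ A
    induction b using StabClass.ind with | _ B
    induction c using StabClass.ind with | _ C
    obtain ⟨P, P', hP, hP', ⟨e⟩⟩ := stabClass_eq_iff.1 h
    refine stabClass_eq_iff.2 ⟨P, P', hP, hP', ?_⟩
    refine nonempty_equiv_of_prod_equiv C (A := FGModuleCat.of R (A × P))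
      (B := FGModuleCat.of R (B × P')) ?_
    exact (LinearEquiv.prodAssoc R A P C).trans <|
      ((LinearEquiv.refl R A).prodCongr (LinearEquiv.prodComm R P C)).trans <|
      (LinearEquiv.prodAssoc R A C P).symm.trans <| e.trans <|
      (LinearEquiv.prodAssoc R B C P').trans <|
      ((LinearEquiv.refl R B).prodCongr (LinearEquiv.prodComm R C P')).trans
      (LinearEquiv.prodAssoc R B P' C).symm⟩
  AddCommMagma.IsRightCancelAdd.toIsCancelAdd (StabClass R)

/-- The defining relations of `K` hold for stable classes, so `K` maps to the Grothendieck group of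
the cancellative monoid `StabClass R`, where distinct stable classes stay distinct. -/
theorem kClass_eq_iff {A B : FGModuleCat.{u} R} : kClass A = kClass B ↔ StabEq A B := by
  constructor
  · intro h
    let φ : KGroup R →+ Algebra.GrothendieckAddGroup (StabClass R) :=
      QuotientAddGroup.lift _ (FreeAbelianGroup.lift fun M =>
        Algebra.GrothendieckAddGroup.of (stabClass M)) <| by
        rw [AddSubgroup.closure_le]
        rintro x (⟨A, B, C, e⟩ | ⟨P, hP⟩)
        · have : stabClass C = stabClass A + stabClass B :=
            stabClass_eq_iff.2 (.of_equiv (B := FGModuleCat.of R (A × B)) e)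
          simp [this]
        · simp [stabClass_projective hP]
    have hφ : ∀ M, φ (kClass M) = Algebra.GrothendieckAddGroup.of (stabClass M) := by
      intro M
      simp [φ, kClass]
    have := congrArg φ h
    rw [hφ, hφ] at this
    exact stabClass_eq_iff.1 (Algebra.GrothendieckAddGroup.of_injective this)
  · rintro ⟨P, P', hP, hP', ⟨e⟩⟩
    have := kClass_congr (A := FGModuleCat.of R (A × P)) (B := FGModuleCat.of R (B × P')) e
    rwa [kClass_prod, kClass_prod, kClass_proj P hP, kClass_proj P' hP', add_zero,
      add_zero] at this

end StableEquivalence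

/-! ### Projective dimension in short exact sequences. -/

section ProjectiveDimension

variable {R : Type u} [Ring R]

theorem pd_le_iff {M : FGModuleCat.{u} R} {n : ℕ} :
    pd M ≤ n ↔ HasProjectiveDimensionLT M.obj (n + 1) := by
  have h : HasProjectiveDimensionLT M.obj (n + 1) ↔ projectiveDimension M.obj ≤ n :=
    (projectiveDimension_le_iff _ _).symm
  rw [h, pd]
  -- The value `⊥` belongs to the zero module; `pd` replaces it by `0`, so both sides hold there.
  rcases hd : projectiveDimension M.obj with _ | d
  · simp [WithBot.none_eq_bot]
  · exact (WithBot.coe_le_coe (a := d) (b := (n : ℕ∞))).symm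

theorem pd_lt_top_iff {M : FGModuleCat.{u} R} : pd M < ⊤ ↔ ∃ n : ℕ, pd M ≤ n := by
  constructor
  · intro h
    exact ⟨(pd M).toNat, (ENat.natCast_toNat h.ne).ge⟩
  · rintro ⟨n, hn⟩
    exact hn.trans_lt (ENat.natCast_lt_top n)

theorem pd_le_zero_iff {M : FGModuleCat.{u} R} : pd M ≤ 0 ↔ Module.Projective R M := by
  have h := pd_le_iff (M := M) (n := 0)
  rw [Nat.cast_zero, zero_add, ← projective_iff_hasProjectiveDimensionLT_one] at h
  exact h.trans (IsProjective.iff_projective (R := R) M).symm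

theorem IsRetract.pd_le {X M : FGModuleCat.{u} R} (h : IsRetract X M) : pd X ≤ pd M := by
  obtain ⟨i, p, hp⟩ := h
  let r : Retract X.obj M.obj :=
    { i := ModuleCat.ofHom i
      r := ModuleCat.ofHom p
      retract := by ext x; exact LinearMap.congr_fun hp x }
  by_cases hM : pd M = ⊤
  · exact hM ▸ le_top
  · obtain ⟨n, hn⟩ := ENat.ne_top_iff_exists.1 hM
    have hn' := pd_le_iff.1 hn.ge
    rw [← hn, pd_le_iff]
    exact r.hasProjectiveDimensionLT _

variable {A B C : FGModuleCat.{u} R}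

theorem SES.pd_mid_le (h : SES A B C) {n : ℕ} (hA : pd A ≤ n) (hC : pd C ≤ n) : pd B ≤ n := by
  obtain ⟨f, g, h⟩ := h
  rw [pd_le_iff] at *
  exact h.shortExact.hasProjectiveDimensionLT_X₂ _ hA hC

theorem SES.pd_right_le (h : SES A B C) {n : ℕ} (hA : pd A ≤ n) (hB : pd B ≤ n + 1) :
    pd C ≤ n + 1 := by
  obtain ⟨f, g, h⟩ := h
  have hB' : pd B ≤ (n + 1 : ℕ) := by exact_mod_cast hB
  suffices pd C ≤ (n + 1 : ℕ) by exact_mod_cast this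
  rw [pd_le_iff] at *
  exact h.shortExact.hasProjectiveDimensionLT_X₃ _ hA hB'

theorem SES.pd_left_le (h : SES A B C) {n : ℕ} (hB : pd B ≤ n) (hC : pd C ≤ n + 1) :
    pd A ≤ n := by
  obtain ⟨f, g, h⟩ := h
  have hC' : pd C ≤ (n + 1 : ℕ) := by exact_mod_cast hC
  rw [pd_le_iff] at *
  exact h.shortExact.hasProjectiveDimensionLT_X₁ _ hB hC'

theorem SES.prod (A B : FGModuleCat.{u} R) : SES A (FGModuleCat.of R (A × B)) B :=
  ⟨_, _, isSES_prod A B⟩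

theorem pd_prod_le {n : ℕ} (hA : pd A ≤ n) (hB : pd B ≤ n) :
    pd (FGModuleCat.of R (A × B)) ≤ n :=
  (SES.prod A B).pd_mid_le hA hB

theorem SES.congr {A' B' C' : FGModuleCat.{u} R} (h : SES A B C) (a : A ≃ₗ[R] A')
    (b : B ≃ₗ[R] B') (c : C ≃ₗ[R] C') : SES A' B' C' := by
  obtain ⟨f, g, h⟩ := h
  refine ⟨b.toLinearMap ∘ₗ f ∘ₗ a.symm.toLinearMap, c.toLinearMap ∘ₗ g ∘ₗ b.symm.toLinearMap,
    b.injective.comp (h.inj.comp a.symm.injective), fun x => ?_,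
    c.surjective.comp (h.surj.comp b.symm.surjective)⟩
  change c (g (b.symm x)) = 0 ↔ ∃ y, b (f (a.symm y)) = x
  rw [c.map_eq_zero_iff, h.exact (b.symm x)]
  constructor
  · rintro ⟨y, hy⟩
    exact ⟨a y, by rw [a.symm_apply_apply, hy, b.apply_symm_apply]⟩
  · rintro ⟨y, hy⟩
    exact ⟨a.symm y, by rw [← hy, b.symm_apply_apply]⟩

/-- Pulling back along a map that lifts. -/
theorem IsSES.ses_of_lift {f : A →ₗ[R] B} {g : B →ₗ[R] C} (h : IsSES f g)
    {K Q : FGModuleCat.{u} R} {i : K →ₗ[R] Q} {p : Q →ₗ[R] C} (h' : IsSES i p) {l : Q →ₗ[R] B}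
    (hl : g ∘ₗ l = p) : SES K (FGModuleCat.of R (A × Q)) B := by
  have hl' : ∀ x, g (l x) = p x := fun x => LinearMap.congr_fun hl x
  let e := LinearEquiv.ofInjective f h.inj
  have he : ∀ y, f (e.symm y) = y := fun y => congrArg Subtype.val (e.apply_symm_apply y)
  have hm : ∀ k, l (i k) ∈ LinearMap.range f := fun k => by
    obtain ⟨a, ha⟩ := (h.exact (l (i k))).1 (by rw [hl', h'.exact.apply_apply_eq_zero])
    exact ⟨a, ha⟩
  let w : K →ₗ[R] A :=
    e.symm.toLinearMap ∘ₗ LinearMap.codRestrict (LinearMap.range f) (l ∘ₗ i) hm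
  have hw : ∀ k, f (w k) = l (i k) := fun k => he _
  -- The lift `l` identifies the fibre product of `B` and `Q` over `C` with `A × Q`; `w` measures
  -- `l` on `K`, and the sign makes the composite vanish.
  refine ⟨LinearMap.prod (-w) i, LinearMap.coprod f l, ?_, ?_, ?_⟩
  · intro x y hxy
    exact h'.inj (congrArg Prod.snd hxy)
  · rintro ⟨a, q⟩
    change f a + l q = 0 ↔ ∃ k, ((-w k, i k) : A × Q) = (a, q)
    constructor
    · intro h0
      have h1 : p q = 0 := by
        have := congrArg g h0
        rwa [map_add, h.exact.apply_apply_eq_zero, zero_add, hl', map_zero] at this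
      obtain ⟨k, rfl⟩ := (h'.exact q).1 h1
      refine ⟨k, Prod.ext (h.inj ?_) rfl⟩
      rw [map_neg, hw]
      exact (eq_neg_of_add_eq_zero_left h0).symm
    · rintro ⟨k, hk⟩
      obtain ⟨rfl, rfl⟩ := Prod.mk.inj hk
      rw [map_neg, hw, neg_add_cancel]
  · intro b
    obtain ⟨q, hq⟩ := h'.surj (g b)
    obtain ⟨a, ha⟩ := (h.exact (b - l q)).1 (by rw [map_sub, hl', hq, sub_self])
    exact ⟨(a, q), show f a + l q = b by rw [ha, sub_add_cancel]⟩

theorem IsSES.exists_lift_of_projective {f : A →ₗ[R] B} {g : B →ₗ[R] C} (h : IsSES f g)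
    {P : FGModuleCat.{u} R} (hP : Module.Projective R P) (p : P →ₗ[R] C) :
    ∃ l : P →ₗ[R] B, g ∘ₗ l = p :=
  Module.projective_lifting_property g p h.surj

theorem IsSES.equiv_of_section {f : A →ₗ[R] B} {g : B →ₗ[R] C} (h : IsSES f g)
    {l : C →ₗ[R] B} (hl : g ∘ₗ l = LinearMap.id) : Nonempty (B ≃ₗ[R] (A × C)) := by
  have hl' : ∀ x, g (l x) = x := fun x => LinearMap.congr_fun hl x
  refine ⟨(LinearEquiv.ofBijective (LinearMap.coprod f l) ⟨?_, ?_⟩).symm⟩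
  · rw [← LinearMap.ker_eq_bot, LinearMap.ker_eq_bot']
    rintro ⟨a, c⟩ h0
    change f a + l c = 0 at h0
    have h1 := congrArg g h0
    rw [map_add, h.exact.apply_apply_eq_zero, zero_add, hl', map_zero] at h1
    subst h1
    rw [map_zero, add_zero] at h0
    rw [(map_eq_zero_iff f h.inj).1 h0]
    rfl
  · intro b
    obtain ⟨a, ha⟩ := (h.exact (b - l (g b))).1 (by rw [map_sub, hl', sub_self])
    exact ⟨(a, g b), show f a + l (g b) = b by rw [ha, sub_add_cancel]⟩

end ProjectiveDimension

/-! ### Projective covers, syzygies and the horseshoe lemma. -/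

section Syzygies

variable {R : Type u} [Ring R]

/-- A lift `h` of `e` is onto because the kernel of `f'` is superfluous. Its section is onto because
the kernel of `f` is superfluous, so `h` is also injective. -/
theorem IsProjCover.exists_equiv {P P' M M' : FGModuleCat.{u} R} {f : P →ₗ[R] M}
    {f' : P' →ₗ[R] M'} (hf : IsProjCover f) (hf' : IsProjCover f') (e : M ≃ₗ[R] M') :
    ∃ e' : P ≃ₗ[R] P', ∀ x, f' (e' x) = e (f x) := by
  have := hf.projective
  have := hf'.projective
  obtain ⟨h, hh⟩ := Module.projective_lifting_property f' (e.toLinearMap ∘ₗ f) hf'.surjective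
  have hh' : ∀ x, f' (h x) = e (f x) := fun x => LinearMap.congr_fun hh x
  have hs : Function.Surjective h := by
    rw [← LinearMap.range_eq_top]
    refine hf'.superfluous _ (eq_top_iff.2 fun y _ => ?_)
    obtain ⟨x, hx⟩ := hf.surjective (e.symm (f' y))
    refine Submodule.mem_sup.2 ⟨h x, ⟨x, rfl⟩, y - h x, ?_, by abel⟩
    rw [LinearMap.mem_ker, map_sub, hh', hx, e.apply_symm_apply, sub_self]
  obtain ⟨σ, hσ⟩ := Module.projective_lifting_property h LinearMap.id hs
  have hσ' : ∀ y, h (σ y) = y := fun y => LinearMap.congr_fun hσ y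
  have hr : Function.Surjective σ := by
    rw [← LinearMap.range_eq_top]
    refine hf.superfluous _ (eq_top_iff.2 fun x _ => ?_)
    refine Submodule.mem_sup.2 ⟨σ (h x), ⟨h x, rfl⟩, x - σ (h x), ?_, by abel⟩
    rw [LinearMap.mem_ker, ← e.map_eq_zero_iff, ← hh', map_sub, hσ', sub_self, map_zero]
  have hi : Function.Injective h := by
    intro x y hxy
    obtain ⟨x, rfl⟩ := hr x
    obtain ⟨y, rfl⟩ := hr y
    rw [hσ', hσ'] at hxy
    rw [hxy]
  exact ⟨LinearEquiv.ofBijective h ⟨hi, hs⟩, hh'⟩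

theorem IsProjCover.ker_equiv {P P' M M' : FGModuleCat.{u} R} {f : P →ₗ[R] M}
    {f' : P' →ₗ[R] M'} (hf : IsProjCover f) (hf' : IsProjCover f') (e : M ≃ₗ[R] M') :
    Nonempty (LinearMap.ker f ≃ₗ[R] LinearMap.ker f') := by
  obtain ⟨e', he⟩ := hf.exists_equiv hf' e
  refine ⟨e'.ofSubmodules _ _ ?_⟩
  ext y
  rw [Submodule.mem_map, LinearMap.mem_ker]
  constructor
  · rintro ⟨x, hx, rfl⟩
    exact (he x).trans (by rw [LinearMap.mem_ker.1 hx, map_zero])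
  · intro hy
    refine ⟨e'.symm y, ?_, e'.apply_symm_apply y⟩
    rw [LinearMap.mem_ker, ← e.map_eq_zero_iff, ← he, e'.apply_symm_apply, hy]

/-- The image of a superfluous submodule is superfluous. -/
theorem eq_top_of_sup_map_eq_top {P T : Type*} [AddCommGroup P] [Module R P] [AddCommGroup T]
    [Module R T] {K : Submodule R P} (hK : ∀ N : Submodule R P, N ⊔ K = ⊤ → N = ⊤)
    (j : P →ₗ[R] T) {N : Submodule R T} (hN : N ⊔ K.map j = ⊤) : N = ⊤ := by
  have h : N.comap j = ⊤ := by
    refine hK _ (eq_top_iff.2 fun x _ => ?_)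
    obtain ⟨n, hn, _, ⟨k, hk, rfl⟩, h⟩ := Submodule.mem_sup.1 (hN ▸ Submodule.mem_top : j x ∈ _)
    refine Submodule.mem_sup.2 ⟨x - k, ?_, k, hk, by abel⟩
    rw [Submodule.mem_comap, map_sub, ← h, add_sub_cancel_right]
    exact hn
  rw [← hN, eq_comm, sup_eq_left, Submodule.map_le_iff_le_comap, h]
  exact le_top

theorem IsProjCover.prod {P P' M M' : FGModuleCat.{u} R} {f : P →ₗ[R] M}
    {f' : P' →ₗ[R] M'} (hf : IsProjCover f) (hf' : IsProjCover f') :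
    IsProjCover (P := FGModuleCat.of R (P × P')) (M := FGModuleCat.of R (M × M'))
      (f.prodMap f') where
  projective := by
    have := hf.projective
    have := hf'.projective
    exact inferInstanceAs (Module.Projective R (P × P'))
  surjective := hf.surjective.prodMap hf'.surjective
  superfluous N hN := by
    refine eq_top_of_sup_map_eq_top hf.superfluous (LinearMap.inl R P P') ?_
    refine eq_top_of_sup_map_eq_top hf'.superfluous (LinearMap.inr R P P') ?_
    rw [sup_assoc, eq_top_iff, ← hN]
    refine sup_le_sup_left ?_ _
    rintro ⟨x, y⟩ hxy
    have h1 : f x = 0 := congrArg Prod.fst hxy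
    have h2 : f' y = 0 := congrArg Prod.snd hxy
    exact Submodule.mem_sup.2 ⟨(x, 0), ⟨x, h1, rfl⟩, (0, y), ⟨y, h2, rfl⟩, by simp⟩

variable [IsArtinianRing R] {A B C : FGModuleCat.{u} R}

theorem syzygy_congr (e : A ≃ₗ[R] B) : Nonempty (syzygy A ≃ₗ[R] syzygy B) :=
  (isProjCover_projCoverMap A).ker_equiv (isProjCover_projCoverMap B) e

theorem syzygy_prod (A B : FGModuleCat.{u} R) :
    Nonempty (syzygy (FGModuleCat.of R (A × B)) ≃ₗ[R] (syzygy A × syzygy B)) := by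
  obtain ⟨e⟩ := (isProjCover_projCoverMap (FGModuleCat.of R (A × B))).ker_equiv
    ((isProjCover_projCoverMap A).prod (isProjCover_projCoverMap B)) (LinearEquiv.refl R _)
  exact ⟨e.trans
    { toFun := fun x => (⟨x.1.1, congrArg Prod.fst x.2⟩, ⟨x.1.2, congrArg Prod.snd x.2⟩)
      invFun := fun y => ⟨(y.1.1, y.2.1), Prod.ext y.1.2 y.2.2⟩
      map_add' := fun _ _ => rfl
      map_smul' := fun _ _ => rfl
      left_inv := fun _ => rfl
      right_inv := fun _ => rfl }⟩

theorem syzygy_iterate_congr (n : ℕ) (e : A ≃ₗ[R] B) :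
    Nonempty (syzygy^[n] A ≃ₗ[R] syzygy^[n] B) := by
  induction n generalizing A B with
  | zero => exact ⟨e⟩
  | succ n ih =>
    obtain ⟨e'⟩ := syzygy_congr e
    exact ih e'

theorem syzygy_iterate_prod (n : ℕ) (A B : FGModuleCat.{u} R) :
    Nonempty (syzygy^[n] (FGModuleCat.of R (A × B)) ≃ₗ[R] (syzygy^[n] A × syzygy^[n] B)) := by
  induction n generalizing A B with
  | zero => exact ⟨LinearEquiv.refl R _⟩
  | succ n ih =>
    obtain ⟨e⟩ := syzygy_prod A B
    obtain ⟨e'⟩ := syzygy_iterate_congr n (B := FGModuleCat.of R (syzygy A × syzygy B)) e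
    obtain ⟨e''⟩ := ih (syzygy A) (syzygy B)
    exact ⟨e'.trans e''⟩

theorem IsRetract.syzygy_iterate (h : IsRetract A B) (n : ℕ) :
    IsRetract (syzygy^[n] A) (syzygy^[n] B) := by
  obtain ⟨i, p, hp⟩ := h
  obtain ⟨e⟩ := exists_equiv_prod_ker hp
  obtain ⟨e'⟩ := syzygy_iterate_congr n (B := FGModuleCat.of R (A × _)) e
  obtain ⟨e''⟩ := syzygy_iterate_prod n A (FGModuleCat.of R (LinearMap.ker p))
  exact (isRetract_prod_left _ _).trans
    (isRetract_of_equiv (X := FGModuleCat.of R (_ × _)) (e'.trans e'').symm)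

theorem ses_syzygy (M : FGModuleCat.{u} R) : SES (syzygy M) (projCover M) M :=
  ⟨_, _, isSES_ker (isProjCover_projCoverMap M).surjective⟩

theorem projective_projCover (M : FGModuleCat.{u} R) : Module.Projective R (projCover M) :=
  (isProjCover_projCoverMap M).projective

theorem pd_le_of_pd_syzygy_le {M : FGModuleCat.{u} R} {n : ℕ} (h : pd (syzygy M) ≤ n) :
    pd M ≤ (n + 1 : ℕ) := by
  have := (ses_syzygy M).pd_right_le h
    ((pd_le_zero_iff.2 (projective_projCover M)).trans zero_le)
  exact_mod_cast this

theorem pd_syzygy_le {M : FGModuleCat.{u} R} {n : ℕ} (h : pd M ≤ (n + 1 : ℕ)) :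
    pd (syzygy M) ≤ n :=
  (ses_syzygy M).pd_left_le ((pd_le_zero_iff.2 (projective_projCover M)).trans zero_le)
    (by exact_mod_cast h)

theorem pd_le_of_pd_syzygy_iterate_le {M : FGModuleCat.{u} R} {n : ℕ} (j : ℕ)
    (h : pd (syzygy^[j] M) ≤ n) : pd M ≤ (n + j : ℕ) := by
  induction j generalizing M with
  | zero => exact h
  | succ j ih => exact pd_le_of_pd_syzygy_le (ih h)

theorem pd_syzygy_iterate_le {M : FGModuleCat.{u} R} {n : ℕ} (j : ℕ)
    (h : pd M ≤ (n + j : ℕ)) : pd (syzygy^[j] M) ≤ n := by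
  induction j generalizing M with
  | zero => exact h
  | succ j ih => exact ih (pd_syzygy_le h)

theorem pd_syzygy_iterate_lt_top {M : FGModuleCat.{u} R} (j : ℕ) (h : pd M < ⊤) :
    pd (syzygy^[j] M) < ⊤ := by
  obtain ⟨n, hn⟩ := pd_lt_top_iff.1 h
  exact pd_lt_top_iff.2 ⟨n, pd_syzygy_iterate_le j
    (hn.trans (by exact_mod_cast Nat.le_add_right n j))⟩

theorem projective_syzygy_iterate {M : FGModuleCat.{u} R} {s : ℕ} (h : pd M ≤ s) :
    Module.Projective R (syzygy^[s] M : FGModuleCat.{u} R) := by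
  rw [← pd_le_zero_iff]
  exact_mod_cast pd_syzygy_iterate_le (n := 0) s (by rwa [zero_add])

theorem kClass_syzygy_iterate (n : ℕ) (M : FGModuleCat.{u} R) :
    kClass (syzygy^[n] M) = (kOmega R)^[n] (kClass M) := by
  induction n generalizing M with
  | zero => rfl
  | succ n ih => rw [Function.iterate_succ_apply, Function.iterate_succ_apply, ih, kOmega_kClass]

/-- By Schanuel's lemma, any projective presentation computes the syzygy in `K`, minimal or not. -/
theorem IsSES.kClass_eq {K P M : FGModuleCat.{u} R} {i : K →ₗ[R] P} {p : P →ₗ[R] M}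
    (h : IsSES i p) (hP : Module.Projective R P) : kClass K = kOmega R (kClass M) := by
  rw [kOmega_kClass]
  have hr : LinearMap.range i = LinearMap.ker p := (LinearMap.exact_iff.1 h.exact).symm
  have e : K ≃ₗ[R] FGModuleCat.of R (LinearMap.ker p) :=
    (LinearEquiv.ofInjective i h.inj).trans (LinearEquiv.ofEq _ _ hr)
  rw [kClass_congr e]
  exact kClass_ker_eq hP (projective_projCover M) (LinearEquiv.refl R M) p _ h.surj
    (isProjCover_projCoverMap M).surjective

theorem pd_le_of_kClass_eq (h : kClass A = kClass B) {n : ℕ} (hA : pd A ≤ n) : pd B ≤ n := by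
  obtain ⟨P, P', hP, hP', ⟨e⟩⟩ := kClass_eq_iff.1 h
  have h1 : IsRetract B (FGModuleCat.of R (A × P)) := (isRetract_prod_left B P').trans
    (isRetract_of_equiv (X := FGModuleCat.of R (B × P')) e.symm)
  exact h1.pd_le.trans (pd_prod_le hA ((pd_le_zero_iff.2 hP).trans zero_le))

theorem pd_lt_top_of_kClass_eq (h : kClass A = kClass B) (hA : pd A < ⊤) : pd B < ⊤ := by
  obtain ⟨n, hn⟩ := pd_lt_top_iff.1 hA
  exact pd_lt_top_iff.2 ⟨n, pd_le_of_kClass_eq h hn⟩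

/-- The sum of the projective covers of the ends maps onto `B`, but need not be its projective
cover. Hence the middle kernel `B'` is a syzygy of `B` only up to projective summands, which is all
that its class in `K` records. -/
theorem SES.horseshoe (h : SES A B C) :
    ∃ B' : FGModuleCat.{u} R, kClass B' = kOmega R (kClass B) ∧
      SES (syzygy A) B' (syzygy C) := by
  obtain ⟨f, g, h⟩ := h
  obtain ⟨l, hl⟩ := h.exists_lift_of_projective (projective_projCover C) (projCoverMap C)
  have hl' : ∀ x, g (l x) = projCoverMap C x := fun x => LinearMap.congr_fun hl x
  have hA := isProjCover_projCoverMap A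
  have hC := isProjCover_projCoverMap C
  let P : FGModuleCat.{u} R := FGModuleCat.of R (projCover A × projCover C)
  have hP : Module.Projective R P := by
    have := hA.projective
    have := hC.projective
    exact inferInstanceAs (Module.Projective R (projCover A × projCover C))
  let π : P →ₗ[R] B := LinearMap.coprod (f ∘ₗ projCoverMap A) l
  have hπ : ∀ x y, π (x, y) = f (projCoverMap A x) + l y := fun x y => rfl
  have hs : Function.Surjective π := by
    intro b
    obtain ⟨y, hy⟩ := hC.surjective (g b)
    obtain ⟨a, ha⟩ := (h.exact (b - l y)).1 (by rw [map_sub, hl', hy, sub_self])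
    obtain ⟨x, rfl⟩ := hA.surjective a
    exact ⟨(x, y), by rw [hπ, ha, sub_add_cancel]⟩
  refine ⟨_, (isSES_ker hs).kClass_eq hP, ?_⟩
  let i : syzygy A →ₗ[R] FGModuleCat.of R (LinearMap.ker π) :=
    LinearMap.codRestrict (LinearMap.ker π)
      (LinearMap.inl R (projCover A) (projCover C) ∘ₗ (LinearMap.ker (projCoverMap A)).subtype)
      fun x => by
        have hx : projCoverMap A x.1 = 0 := x.2
        change f (projCoverMap A x.1) + l 0 = 0
        rw [hx, map_zero, map_zero, add_zero]
  let q : FGModuleCat.of R (LinearMap.ker π) →ₗ[R] syzygy C :=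
    LinearMap.codRestrict (LinearMap.ker (projCoverMap C))
      (LinearMap.snd R (projCover A) (projCover C) ∘ₗ (LinearMap.ker π).subtype)
      fun x => by
        have hx : f (projCoverMap A x.1.1) + l x.1.2 = 0 := x.2
        have := congrArg g hx
        rwa [map_add, h.exact.apply_apply_eq_zero, zero_add, hl', map_zero] at this
  refine ⟨i, q, ?_, ?_, ?_⟩
  · intro x y hxy
    exact Subtype.ext (congrArg Prod.fst (congrArg Subtype.val hxy))
  · rintro ⟨⟨x, y⟩, hxy⟩
    have hxy' : f (projCoverMap A x) + l y = 0 := hxy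
    constructor
    · intro h0
      obtain rfl : y = 0 := congrArg Subtype.val h0
      rw [map_zero, add_zero, map_eq_zero_iff f h.inj] at hxy'
      exact ⟨⟨x, hxy'⟩, rfl⟩
    · rintro ⟨z, hz⟩
      exact Subtype.ext (congrArg Prod.snd (congrArg Subtype.val hz)).symm
  · rintro ⟨y, hy⟩
    have hy' : projCoverMap C y = 0 := hy
    obtain ⟨a, ha⟩ := (h.exact (l y)).1 (by rw [hl', hy'])
    obtain ⟨x, rfl⟩ := hA.surjective a
    refine ⟨⟨(-x, y), ?_⟩, rfl⟩
    change f (projCoverMap A (-x)) + l y = 0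
    rw [map_neg, map_neg, ha, neg_add_cancel]

theorem SES.horseshoe_iterate (h : SES A B C) (n : ℕ) :
    ∃ B' : FGModuleCat.{u} R, kClass B' = kClass (syzygy^[n] B) ∧
      SES (syzygy^[n] A) B' (syzygy^[n] C) := by
  induction n with
  | zero => exact ⟨B, rfl, h⟩
  | succ n ih =>
    obtain ⟨B', hB', h'⟩ := ih
    obtain ⟨B'', hB'', h''⟩ := h'.horseshoe
    refine ⟨B'', ?_, ?_⟩
    · rw [hB'', hB', Function.iterate_succ_apply', kOmega_kClass]
    · rwa [Function.iterate_succ_apply', Function.iterate_succ_apply']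

/-- Rotation of a short exact sequence. -/
theorem SES.rotate (h : SES A B C) :
    SES (syzygy C) (FGModuleCat.of R (A × projCover C)) B := by
  obtain ⟨f, g, h⟩ := h
  obtain ⟨l, hl⟩ := h.exists_lift_of_projective (projective_projCover C) (projCoverMap C)
  exact h.ses_of_lift (isSES_ker (isProjCover_projCoverMap C).surjective) hl

/-- After `s` syzygies the left term is projective. Rotating then presents the middle term by a
projective module with kernel `Ω^(s+1) C`; this rotation costs the extra syzygy. -/
theorem SES.kClass_syzygy_of_pd_left_le (h : SES A B C) {s : ℕ} (hA : pd A ≤ s) :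
    kClass (syzygy^[s + 1] B) = kClass (syzygy^[s + 1] C) := by
  obtain ⟨B', hB', h'⟩ := h.horseshoe_iterate s
  obtain ⟨i, p, h''⟩ := h'.rotate
  have hP : Module.Projective R
      ((syzygy^[s] A : FGModuleCat.{u} R) × projCover (syzygy^[s] C)) := by
    have := projective_syzygy_iterate hA
    have := projective_projCover (syzygy^[s] C)
    infer_instance
  have := h''.kClass_eq hP
  rw [hB', kOmega_kClass] at this
  rw [Function.iterate_succ_apply', Function.iterate_succ_apply', this]

/-- After `s` syzygies the right term is projective and the sequence splits. -/
theorem SES.kClass_syzygy_of_pd_right_le (h : SES A B C) {s : ℕ} (hC : pd C ≤ s) :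
    kClass (syzygy^[s + 1] B) = kClass (syzygy^[s + 1] A) := by
  obtain ⟨B', hB', ⟨i, p, h'⟩⟩ := h.horseshoe_iterate s
  have hP := projective_syzygy_iterate hC
  obtain ⟨l, hl⟩ := h'.exists_lift_of_projective hP LinearMap.id
  obtain ⟨e⟩ := h'.equiv_of_section hl
  have : kClass (syzygy^[s] B) = kClass (syzygy^[s] A) := by
    rw [← hB', kClass_sum e, kClass_proj _ hP, add_zero]
  rw [Function.iterate_succ_apply', Function.iterate_succ_apply', ← kOmega_kClass, this,
    kOmega_kClass]

end Syzygies

/-! ### Contravariance of `Ext`, Fitting decompositions and the key estimate. -/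

section ExtPullback

variable {R : Type u} [Ring R]

/-- Functoriality of `Extᵏ(-, S)`. -/
noncomputable def extPull {X Y : FGModuleCat.{u} R} (φ : X →ₗ[R] Y) {S : ModuleCat.{u} R} {k : ℕ}
    (x : Abelian.Ext.{u} Y.obj S k) : Abelian.Ext.{u} X.obj S k :=
  (Abelian.Ext.mk₀ (ModuleCat.ofHom φ : X.obj ⟶ Y.obj)).comp x (zero_add k)

variable {X Y Z : FGModuleCat.{u} R} {S : ModuleCat.{u} R} {k : ℕ}

theorem extPull_id (x : Abelian.Ext.{u} X.obj S k) : extPull LinearMap.id x = x :=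
  Abelian.Ext.mk₀_id_comp x

theorem extPull_comp (φ : X →ₗ[R] Y) (ψ : Y →ₗ[R] Z) (x : Abelian.Ext.{u} Z.obj S k) :
    extPull (ψ ∘ₗ φ) x = extPull φ (extPull ψ x) :=
  (Abelian.Ext.mk₀_comp_mk₀_assoc (ModuleCat.ofHom φ : X.obj ⟶ Y.obj)
    (ModuleCat.ofHom ψ : Y.obj ⟶ Z.obj) x).symm

theorem extPull_add (φ ψ : X →ₗ[R] Y) (x : Abelian.Ext.{u} Y.obj S k) :
    extPull (φ + ψ) x = extPull φ x + extPull ψ x := by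
  have : (ModuleCat.ofHom (φ + ψ) : X.obj ⟶ Y.obj) =
    (ModuleCat.ofHom φ : X.obj ⟶ Y.obj) + (ModuleCat.ofHom ψ : X.obj ⟶ Y.obj) := rfl
  rw [extPull, this, Abelian.Ext.mk₀_add, Abelian.Ext.add_comp]
  rfl

theorem extPull_zero_left (x : Abelian.Ext.{u} Y.obj S k) :
    extPull (0 : X →ₗ[R] Y) x = 0 := by
  have : (ModuleCat.ofHom (0 : X →ₗ[R] Y) : X.obj ⟶ Y.obj) = 0 := rfl
  rw [extPull, this, Abelian.Ext.mk₀_zero, Abelian.Ext.zero_comp]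

theorem extPull_zero_right (φ : X →ₗ[R] Y) :
    extPull φ (0 : Abelian.Ext.{u} Y.obj S k) = 0 :=
  Abelian.Ext.comp_zero _ _ _ _ _

theorem ext_eq_zero_of_pd_le {n : ℕ} (h : pd X ≤ n) (hk : n + 1 ≤ k)
    (x : Abelian.Ext.{u} X.obj S k) : x = 0 := by
  have := pd_le_iff.1 h
  exact x.eq_zero_of_hasProjectiveDimensionLT (n + 1) hk

theorem extPull_of_factors_projective {P : FGModuleCat.{u} R} (hP : Module.Projective R P)
    (w : X →ₗ[R] P) (r : P →ₗ[R] Y) (hk : 1 ≤ k) (x : Abelian.Ext.{u} Y.obj S k) :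
    extPull (r ∘ₗ w) x = 0 := by
  rw [extPull_comp, ext_eq_zero_of_pd_le (n := 0) (by exact_mod_cast pd_le_zero_iff.2 hP) hk
    (extPull r x), extPull_zero_right]

/-- A stable isomorphism induces isomorphisms on `Extᵏ` for `k ≥ 1`. -/
theorem StabEq.exists_extPull_inverse {A B : FGModuleCat.{u} R} (h : StabEq A B) :
    ∃ (u : B →ₗ[R] A) (v : A →ₗ[R] B), ∀ (S : ModuleCat.{u} R) (k : ℕ), 1 ≤ k →
      (∀ x : Abelian.Ext.{u} A.obj S k, extPull v (extPull u x) = x) ∧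
      (∀ x : Abelian.Ext.{u} B.obj S k, extPull u (extPull v x) = x) := by
  obtain ⟨P, P', hP, hP', ⟨e⟩⟩ := h
  have key : ∀ {A B P P' : FGModuleCat.{u} R} (_ : Module.Projective R P)
      (e : (A × P) ≃ₗ[R] (B × P')) (S : ModuleCat.{u} R) (k : ℕ) (_ : 1 ≤ k)
      (x : Abelian.Ext.{u} B.obj S k),
      extPull (LinearMap.fst R A P ∘ₗ e.symm.toLinearMap ∘ₗ LinearMap.inl R B P' : B →ₗ[R] A)
        (extPull (LinearMap.fst R B P' ∘ₗ e.toLinearMap ∘ₗ LinearMap.inl R A P : A →ₗ[R] B) x) =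
          x := by
    intro A B P P' hP e S k hk x
    let w : B →ₗ[R] P := LinearMap.snd R A P ∘ₗ e.symm.toLinearMap ∘ₗ LinearMap.inl R B P'
    let r : P →ₗ[R] B := LinearMap.fst R B P' ∘ₗ e.toLinearMap ∘ₗ LinearMap.inr R A P
    let u : B →ₗ[R] A := LinearMap.fst R A P ∘ₗ e.symm.toLinearMap ∘ₗ LinearMap.inl R B P'
    let v : A →ₗ[R] B := LinearMap.fst R B P' ∘ₗ e.toLinearMap ∘ₗ LinearMap.inl R A P
    -- The composite `v ∘ u` differs from the identity by a map through the projective `P`, which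
    -- acts as zero on `Extᵏ` for `k ≥ 1`.
    have hid : v ∘ₗ u + r ∘ₗ w = LinearMap.id := by
      refine LinearMap.ext fun b => ?_
      have h1 : ((u b, 0) + (0, w b) : A × P) = e.symm (b, 0) := by
        rw [Prod.mk_add_mk, add_zero, zero_add]
        rfl
      have h2 := congrArg (fun z => (e z).1) h1
      simp only [map_add, e.apply_symm_apply] at h2
      exact h2
    have h3 := extPull_add (v ∘ₗ u) (r ∘ₗ w) x
    rw [hid, extPull_id, extPull_of_factors_projective hP w r hk, add_zero] at h3
    rw [← extPull_comp]
    exact h3.symm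
  exact ⟨_, _, fun S k hk => ⟨key hP' e.symm S k hk, key hP e S k hk⟩⟩

/-- Fitting decomposition of an endomorphism. -/
theorem exists_fitting [IsArtinianRing R] {A : FGModuleCat.{u} R} (h : Module.End R A) :
    ∃ (n : ℕ) (Y : FGModuleCat.{u} R) (i : Y →ₗ[R] A) (p : A →ₗ[R] Y) (g : Module.End R A),
      1 ≤ n ∧ p ∘ₗ i = LinearMap.id ∧ (h ^ n : Module.End R A) ∘ₗ i = 0 ∧
      i ∘ₗ p + g * h ^ n = 1 ∧ i ∘ₗ p + h ^ n * g = 1 := by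
  obtain ⟨n, hn, hn1⟩ :=
    (h.eventually_isCompl_ker_pow_range_pow.and (Filter.eventually_ge_atTop 1)).exists
  let H : Module.End R A := h ^ n
  let K := LinearMap.ker H
  let I := LinearMap.range H
  have hKI : IsCompl K I := hn
  let E₀ : I →ₗ[R] I := LinearMap.codRestrict I (H ∘ₗ I.subtype) fun x => ⟨x.1, rfl⟩
  have hE₀ : Function.Bijective E₀ := by
    constructor
    · rw [← LinearMap.ker_eq_bot, LinearMap.ker_eq_bot']
      intro x hx
      have h1 : x.1 ∈ K ⊓ I := ⟨congrArg Subtype.val hx, x.2⟩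
      rw [hKI.inf_eq_bot] at h1
      exact Subtype.ext h1
    · rintro ⟨_, y, rfl⟩
      obtain ⟨a, ha, b, hb, rfl⟩ := Submodule.mem_sup.1
        (hKI.sup_eq_top ▸ Submodule.mem_top : y ∈ K ⊔ I)
      refine ⟨⟨b, hb⟩, Subtype.ext ?_⟩
      change H b = H (a + b)
      rw [map_add, LinearMap.mem_ker.1 ha, zero_add]
  -- `H` is invertible on its stable image; the witness for `g` below is that inverse, extended by
  -- zero on the kernel.
  let E := LinearEquiv.ofBijective E₀ hE₀
  have hE : ∀ x : I, (E x : A) = H x := fun x => rfl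
  let p : A →ₗ[R] K := Submodule.projectionOnto K I hKI
  let q : A →ₗ[R] I := Submodule.projectionOnto I K hKI.symm
  have hpq : ∀ a, (p a : A) + q a = a := fun a => by
    exact Submodule.projection_add_projection_eq_self hKI a
  refine ⟨n, FGModuleCat.of R K, K.subtype, p, I.subtype ∘ₗ E.symm.toLinearMap ∘ₗ q, hn1, ?_, ?_,
    ?_, ?_⟩
  · ext x
    simp [p]
  · ext x
    exact x.2
  · refine LinearMap.ext fun a => ?_
    change (p a : A) + (E.symm (q (H a)) : A) = a
    have h1 : q (H a) = E (q a) := by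
      have h2 : H a = H (q a) := by
        conv_lhs => rw [← hpq a, map_add, LinearMap.mem_ker.1 (p a).2, zero_add]
      rw [h2, ← hE]
      simp [q]
    rw [h1, E.symm_apply_apply, hpq]
  · refine LinearMap.ext fun a => ?_
    change (p a : A) + H (E.symm (q a)) = a
    rw [← hE, E.apply_symm_apply, hpq]

/-- If `0 → A → B → Z → 0` is exact, `A` and `B` are stably isomorphic and `Z` has finite
projective dimension, then the projective dimension of `Z` is controlled by that of a direct
summand of `A`. -/
theorem SES.exists_retract_pd [IsArtinianRing R] {A B Z : FGModuleCat.{u} R} (hs : SES A B Z)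
    (hAB : StabEq A B) (hZ : pd Z < ⊤) :
    ∃ Y : FGModuleCat.{u} R, IsRetract Y A ∧ pd Y < ⊤ ∧
      ∀ d : ℕ, pd Y ≤ d → pd Z ≤ (d + 1 : ℕ) := by
  obtain ⟨f, g, hs⟩ := hs
  obtain ⟨u, v, huv⟩ := hAB.exists_extPull_inverse
  -- `Y` is the part of `A` on which `u ∘ f` is nilpotent; on the complement `u ∘ f` is invertible.
  obtain ⟨n, Y, i, p, t, hn, hpi, hhi, ht₁, ht₂⟩ := exists_fitting (u ∘ₗ f : Module.End R A)
  have hpow : ((u ∘ₗ f : Module.End R A) ^ n : Module.End R A) =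
      ((u ∘ₗ f : Module.End R A) ^ (n - 1) : Module.End R A) ∘ₗ (u ∘ₗ f) := by
    rw [← Module.End.mul_eq_comp, ← pow_succ, Nat.sub_add_cancel hn]
  have hpow' : ((u ∘ₗ f : Module.End R A) ^ n : Module.End R A) =
      (u ∘ₗ f) ∘ₗ ((u ∘ₗ f : Module.End R A) ^ (n - 1) : Module.End R A) := by
    rw [← Module.End.mul_eq_comp, ← pow_succ', Nat.sub_add_cancel hn]
  refine ⟨Y, ⟨i, p, hpi⟩, ?_, ?_⟩
  · obtain ⟨c, hc⟩ := pd_lt_top_iff.1 hZ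
    refine pd_lt_top_iff.2 ⟨c, pd_le_iff.2 (HasProjectiveDimensionLT.mk fun k hk S y => ?_)⟩
    -- Beyond the projective dimension of `Z`, pulling back along `f` is onto, and `u` is invertible
    -- on `Ext`. So every power of `u ∘ f` acts surjectively; as the `n`-th power kills `Y`,
    -- `Extᵏ(Y, S) = 0`.
    have hsurj : ∀ x : Abelian.Ext.{u} A.obj S k,
        ∃ x' : Abelian.Ext.{u} A.obj S k, extPull (u ∘ₗ f) x' = x := by
      intro x
      obtain ⟨b, hb⟩ := Abelian.Ext.contravariant_sequence_exact₁ hs.shortExact S x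
        (add_comm 1 k) (ext_eq_zero_of_pd_le hc (by omega) _)
      refine ⟨extPull v b, ?_⟩
      rw [extPull_comp, ((huv S k (by omega)).2 b)]
      exact hb
    have hsurj' : ∀ (m : ℕ) (x : Abelian.Ext.{u} A.obj S k),
        ∃ x' : Abelian.Ext.{u} A.obj S k,
          extPull ((u ∘ₗ f : Module.End R A) ^ m : Module.End R A) x' = x := by
      intro m
      induction m with
      | zero => exact fun x => ⟨x, extPull_id x⟩
      | succ m ih =>
        intro x
        obtain ⟨x₁, rfl⟩ := ih x
        obtain ⟨x₂, rfl⟩ := hsurj x₁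
        refine ⟨x₂, ?_⟩
        rw [pow_succ', Module.End.mul_eq_comp, extPull_comp]
    obtain ⟨z, hz⟩ := hsurj' n (extPull p y)
    have h1 := congrArg (extPull i) hz
    rwa [← extPull_comp, ← extPull_comp, hpi, hhi, extPull_id, extPull_zero_left, eq_comm] at h1
  · intro d hd
    -- Above degree `d` the summand `Y` is invisible to `Ext`, so the `n`-th power of `u ∘ f` acts
    -- invertibly, with inverse induced by `t`. Hence `f` induces bijections there.
    have hsplit : ∀ (S : ModuleCat.{u} R) (k : ℕ), d + 1 ≤ k → ∀ φ : Module.End R A,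
        i ∘ₗ p + φ = 1 → ∀ x : Abelian.Ext.{u} A.obj S k, extPull φ x = x := by
      intro S k hk φ hφ x
      have h1 := extPull_add (i ∘ₗ p) φ x
      rw [hφ, extPull_comp, ext_eq_zero_of_pd_le hd hk (extPull i x), extPull_zero_right,
        zero_add] at h1
      exact h1.symm.trans (extPull_id x)
    refine pd_le_iff.2 (HasProjectiveDimensionLT.mk fun k hk S z => ?_)
    obtain ⟨k, rfl⟩ : ∃ l, k = l + 1 := ⟨k - 1, by omega⟩
    -- Injectivity of the map induced by `f` in degree `k + 1` shows that `z` comes from a class `a`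
    -- on `A` of degree `k`. Surjectivity in degree `k` lifts `a` to `B`, so its connecting image
    -- vanishes. Using two consecutive degrees is the source of `d + 1`.
    have h0 : extPull g z = 0 := by
      have h1 : extPull f (extPull g z) = 0 := by
        rw [← extPull_comp, hs.exact.linearMap_comp_eq_zero, extPull_zero_left]
      have h2 : extPull v (extPull g z) = 0 := by
        have h3 := hsplit S (k + 1) (by omega) _ ht₂ (extPull v (extPull g z))
        rw [← h3, Module.End.mul_eq_comp, hpow', extPull_comp, extPull_comp, extPull_comp,
          ((huv S (k + 1) (by omega)).2 _), h1, extPull_zero_right, extPull_zero_right]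
      rw [← (huv S (k + 1) (by omega)).2 (extPull g z), h2, extPull_zero_right]
    obtain ⟨a, rfl⟩ := Abelian.Ext.contravariant_sequence_exact₃ hs.shortExact S z h0
      (add_comm 1 k)
    have h4 : ∃ b : Abelian.Ext.{u} B.obj S k, extPull f b = a := by
      have h5 := hsplit S k (by omega) _ ht₁ (show Abelian.Ext.{u} A.obj S k from a)
      rw [Module.End.mul_eq_comp, hpow, extPull_comp, extPull_comp, extPull_comp] at h5
      exact ⟨_, h5⟩
    obtain ⟨b, rfl⟩ := h4
    exact hs.shortExact.extClass_comp_assoc _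

end ExtPullback

/-! ### The Igusa-Todorov inequality. -/

section IgusaTodorovInequality

variable {R : Type u} [Ring R]

/-- Every indecomposable direct summand of `A` is projective or a direct summand of `M`. -/
def IsAddProj (A M : FGModuleCat.{u} R) : Prop :=
  ∀ X, IsIndecomposable X → IsRetract X A → Module.Projective R X ∨ IsRetract X M

variable {A B C M N : FGModuleCat.{u} R}

theorem IsRetract.isAddProj (h : IsRetract A M) : IsAddProj A M :=
  fun _ _ hX => .inr (hX.trans h)

theorem IsAddProj.of_isRetract (h : IsAddProj A M) (h' : IsRetract B A) : IsAddProj B M :=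
  fun X hX hXB => h X hX (hXB.trans h')

theorem IsAddProj.mono (h : IsAddProj A M) (h' : IsRetract M N) : IsAddProj A N :=
  fun X hX hXA => (h X hX hXA).imp_right fun hXM => hXM.trans h'

theorem isAddProj_of_projective (h : Module.Projective R A) : IsAddProj A M :=
  fun _ _ hX => .inl (hX.projective h)

variable [IsArtinianRing R]

theorem IsAddProj.prod (hA : IsAddProj A M) (hB : IsAddProj B M) :
    IsAddProj (FGModuleCat.of R (A × B)) M :=
  fun X hX hXM => (hX.isRetract_or hXM).elim (hA X hX) (hB X hX)

theorem IsAddProj.of_kClass_eq (hA : IsAddProj A M) (h : kClass A = kClass B) :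
    IsAddProj B M := by
  obtain ⟨P, P', hP, hP', ⟨e⟩⟩ := kClass_eq_iff.1 h
  exact (hA.prod (isAddProj_of_projective hP)).of_isRetract ((isRetract_prod_left B P').trans
    (isRetract_of_equiv (X := FGModuleCat.of R (B × P')) e.symm))

theorem projective_syzygy_iterate_of_projective (h : Module.Projective R M) (n : ℕ) :
    Module.Projective R (syzygy^[n] M : FGModuleCat.{u} R) :=
  projective_syzygy_iterate ((pd_le_zero_iff.2 h).trans zero_le)

theorem IsAddProj.syzygy_iterate (h : IsAddProj A M) (n : ℕ) :
    IsAddProj (syzygy^[n] A) (syzygy^[n] M) := by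
  induction A using fg_induction with
  | zero A hA =>
    exact isAddProj_of_projective (projective_syzygy_iterate_of_projective inferInstance n)
  | indec A hA =>
    rcases h A hA (.refl A) with hp | hr
    · exact isAddProj_of_projective (projective_syzygy_iterate_of_projective hp n)
    · exact (hr.syzygy_iterate n).isAddProj
  | prod A B hA hB =>
    obtain ⟨e⟩ := syzygy_iterate_prod n A B
    exact ((hA (h.of_isRetract (isRetract_prod_left A B))).prod
      (hB (h.of_isRetract (isRetract_prod_right A B)))).of_isRetract
      (isRetract_of_equiv (Y := FGModuleCat.of R (_ × _)) e)
  | equiv A B e hA =>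
    exact (hA (h.of_isRetract (isRetract_of_equiv e))).of_isRetract
      ((isRetract_of_equiv e.symm).syzygy_iterate n)

/-- Projective summands vanish in `K`, so only the generators of `⟨M⟩` remain. -/
theorem IsAddProj.kClass_mem (h : IsAddProj A M) : kClass A ∈ kSpan M := by
  induction A using fg_induction with
  | zero A hA =>
    rw [kClass_proj A inferInstance]
    exact zero_mem _
  | indec A hA =>
    rcases h A hA (.refl A) with hp | hr
    · rw [kClass_proj A hp]
      exact zero_mem _
    · exact AddSubgroup.subset_closure ⟨A, hA, isRetract_iff_isDirectSummand.1 hr, rfl⟩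
  | prod A B hA hB =>
    rw [kClass_prod]
    exact add_mem (hA (h.of_isRetract (isRetract_prod_left A B)))
      (hB (h.of_isRetract (isRetract_prod_right A B)))
  | equiv A B e hA =>
    rw [← kClass_congr e]
    exact hA (h.of_isRetract (isRetract_of_equiv e))

theorem pd_le_of_indecomposable {n : ℕ}
    (h : ∀ X, IsIndecomposable X → IsRetract X M → pd X ≤ n) : pd M ≤ n := by
  induction M using fg_induction with
  | zero M hM => exact (pd_le_zero_iff.2 inferInstance).trans zero_le
  | indec M hM => exact h M hM (.refl M)
  | prod A B hA hB =>
    exact pd_prod_le (hA fun X hX hXA => h X hX (hXA.trans (isRetract_prod_left A B)))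
      (hB fun X hX hXB => h X hX (hXB.trans (isRetract_prod_right A B)))
  | equiv A B e hA =>
    exact (isRetract_of_equiv e.symm).pd_le.trans
      (hA fun X hX hXA => h X hX (hXA.trans (isRetract_of_equiv e)))

/-- The projective dimensions of the direct summands of `M` which are finite are bounded. -/
theorem pfd_directSummands_lt_top (M : FGModuleCat.{u} R) :
    pfd (fun X => IsDirectSummand X M) < ⊤ := by
  obtain ⟨L, hL⟩ := exists_indecomposable_list M
  -- Members of infinite projective dimension contribute `0` here, which is harmless: only those of
  -- finite dimension are compared with `b`.
  obtain ⟨b, hb⟩ : ∃ b : ℕ, ∀ Y ∈ L, (pd Y).toNat ≤ b :=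
    ⟨(L.map fun Y => (pd Y).toNat).sum, fun Y hY =>
      List.le_sum_of_mem (List.mem_map.2 ⟨Y, hY, rfl⟩)⟩
  refine lt_of_le_of_lt (iSup₂_le fun X hX => ?_) (ENat.natCast_lt_top b)
  refine pd_le_of_indecomposable fun Z hZ hZX => ?_
  obtain ⟨Y, hY, ⟨e⟩⟩ := hL Z hZ (hZX.trans (isRetract_iff_isDirectSummand.2 hX.1))
  have h1 : pd Z ≤ pd Y := (isRetract_of_equiv e).pd_le
  have h2 : pd Y < ⊤ := ((isRetract_of_equiv e.symm).pd_le.trans hZX.pd_le).trans_lt hX.2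
  rw [← ENat.natCast_toNat h2.ne] at h1
  exact h1.trans (by exact_mod_cast hb Y hY)

theorem phi_add_pd_le_psi {X : FGModuleCat.{u} R}
    (hX : IsRetract X (syzygy^[igusaTodorovPhi M] M)) (hpd : pd X < ⊤) :
    pd X ≤ (igusaTodorovPsi M - igusaTodorovPhi M : ℕ) := by
  -- Finiteness is needed because `toNat` would send an infinite supremum to `0`.
  rw [igusaTodorovPsi, Nat.add_sub_cancel_left, ENat.natCast_toNat (pfd_directSummands_lt_top _).ne]
  exact le_iSup₂_of_le X ⟨isRetract_iff_isDirectSummand.1 hX, hpd⟩ le_rfl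

theorem phi_le_psi : igusaTodorovPhi M ≤ igusaTodorovPsi M := Nat.le_add_right _ _

theorem mem_kSpanIter_iff {m : ℕ} {x : KGroup R} :
    x ∈ kSpanIter M m ↔ ∃ y ∈ kSpan M, (kOmega R)^[m] y = x := by
  induction m generalizing x with
  | zero => simp [kSpanIter]
  | succ m ih =>
    rw [kSpanIter, Function.iterate_succ_apply', AddSubgroup.mem_map]
    constructor
    · rintro ⟨z, hz, rfl⟩
      obtain ⟨y, hy, rfl⟩ := ih.1 hz
      exact ⟨y, hy, Function.iterate_succ_apply' _ _ _⟩
    · rintro ⟨y, hy, rfl⟩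
      exact ⟨_, ih.2 ⟨y, hy, rfl⟩, (Function.iterate_succ_apply' _ _ _).symm⟩

theorem kSpan_fg (M : FGModuleCat.{u} R) : (kSpan M).FG := by
  obtain ⟨L, hL⟩ := exists_indecomposable_list M
  refine AddSubgroup.fg_iff _ |>.2 ⟨_, rfl, ?_⟩
  refine Set.Finite.subset (L.map kClass).finite_toSet ?_
  rintro _ ⟨X, hX, hXM, rfl⟩
  obtain ⟨Y, hY, ⟨e⟩⟩ := hL X hX (isRetract_iff_isDirectSummand.2 hXM)
  exact List.mem_map.2 ⟨Y, hY, (kClass_congr e).symm⟩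

/-- `⟨M⟩` is a finitely generated abelian group, so the kernels of the powers of `Ω` on it
stabilize, and from then on `Ω` is injective on the images. Thus the infimum defining `Φ(M)` is
attained. -/
theorem exists_bijOn_kSpanIter (M : FGModuleCat.{u} R) :
    ∃ n, ∀ m, n ≤ m → Set.BijOn (kOmega R) (kSpanIter M m) (kSpanIter M (m + 1)) := by
  let G : Submodule ℤ (KGroup R) := AddSubgroup.toIntSubmodule (kSpan M)
  have hG : G.FG := by
    rw [Submodule.fg_iff_addSubgroup_fg]
    exact kSpan_fg M
  have : Module.Finite ℤ G := Module.Finite.iff_fg.2 hG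
  have : IsNoetherian ℤ G := inferInstance
  let T : ℕ → G →ₗ[ℤ] KGroup R := fun n =>
    ((kOmega R).toIntLinearMap ^ n : Module.End ℤ (KGroup R)) ∘ₗ G.subtype
  have hT : ∀ n x, T n x = (kOmega R)^[n] x := fun n x => by
    change ((kOmega R).toIntLinearMap ^ n : Module.End ℤ (KGroup R)) x = _
    rw [Module.End.coe_pow]
    rfl
  let F : ℕ →o Submodule ℤ G :=
    ⟨fun n => LinearMap.ker (T n), monotone_nat_of_le_succ fun n x hx => by
      rw [LinearMap.mem_ker, hT] at hx ⊢
      rw [Function.iterate_succ_apply', hx, map_zero]⟩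
  obtain ⟨n, hn⟩ := monotone_stabilizes_iff_noetherian.2 this F
  refine ⟨n, fun m hm => ⟨fun x hx => ?_, ?_, fun x hx => ?_⟩⟩
  · obtain ⟨y, hy, rfl⟩ := mem_kSpanIter_iff.1 hx
    exact mem_kSpanIter_iff.2 ⟨y, hy, Function.iterate_succ_apply' _ _ _⟩
  · intro x hx y hy hxy
    obtain ⟨x, hx', rfl⟩ := mem_kSpanIter_iff.1 hx
    obtain ⟨y, hy', rfl⟩ := mem_kSpanIter_iff.1 hy
    let z : G := ⟨x, hx'⟩ - ⟨y, hy'⟩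
    have hz : z ∈ F (m + 1) := by
      change T (m + 1) (⟨x, hx'⟩ - ⟨y, hy'⟩) = 0
      rw [map_sub, hT, hT, Function.iterate_succ_apply', Function.iterate_succ_apply', hxy,
        sub_self]
    rw [← hn (m + 1) (by omega), hn m hm] at hz
    have h1 : T m (⟨x, hx'⟩ - ⟨y, hy'⟩) = 0 := hz
    rw [map_sub, hT, hT] at h1
    exact sub_eq_zero.1 h1
  · obtain ⟨y, hy, rfl⟩ := mem_kSpanIter_iff.1 hx
    exact ⟨_, mem_kSpanIter_iff.2 ⟨y, hy, rfl⟩, (Function.iterate_succ_apply' _ _ _).symm⟩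

/-- Injectivity of `Ω` on `Ω^m ⟨M⟩` for `m ≥ Φ(M)` lets one descend to `Φ(M)` one syzygy at a time.
-/
theorem iterate_phi_eq {x y : KGroup R} (hx : x ∈ kSpan M) (hy : y ∈ kSpan M) {m : ℕ}
    (hm : igusaTodorovPhi M ≤ m) (h : (kOmega R)^[m] x = (kOmega R)^[m] y) :
    (kOmega R)^[igusaTodorovPhi M] x = (kOmega R)^[igusaTodorovPhi M] y := by
  have hspec := Nat.sInf_mem (exists_bijOn_kSpanIter M)
  induction m, hm using Nat.le_induction with
  | base => exact h
  | succ m hm ih =>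
    refine ih ((hspec m hm).injOn (mem_kSpanIter_iff.2 ⟨x, hx, rfl⟩)
      (mem_kSpanIter_iff.2 ⟨y, hy, rfl⟩) ?_)
    rwa [Function.iterate_succ_apply', Function.iterate_succ_apply'] at h

/-- The Igusa-Todorov inequality. -/
theorem SES.pd_le_psi (h : SES A B C) (hA : IsAddProj A M) (hB : IsAddProj B M)
    (hC : pd C < ⊤) : pd C ≤ (igusaTodorovPsi M + 1 : ℕ) := by
  obtain ⟨r, hr⟩ := pd_lt_top_iff.1 hC
  set n := igusaTodorovPhi M with hn
  have hr' : pd C ≤ (max r n : ℕ) := hr.trans (by exact_mod_cast le_max_left r n)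
  -- The classes of `A` and `B` agree after enough syzygies because `C` has finite projective
  -- dimension; both lie in `⟨M⟩`, so they already agree after `Φ(M)` syzygies.
  have hAB : kClass (syzygy^[n] A) = kClass (syzygy^[n] B) := by
    have h1 := h.kClass_syzygy_of_pd_right_le hr'
    rw [kClass_syzygy_iterate, kClass_syzygy_iterate] at h1 ⊢
    exact iterate_phi_eq hA.kClass_mem hB.kClass_mem (by omega) h1.symm
  obtain ⟨B', hB', h'⟩ := h.horseshoe_iterate n
  obtain ⟨Y, hY, hYtop, hYd⟩ := h'.exists_retract_pd (kClass_eq_iff.1 (hAB.trans hB'.symm))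
    (pd_syzygy_iterate_lt_top n hC)
  have hd : pd Y ≤ (igusaTodorovPsi M - n : ℕ) := by
    refine pd_le_of_indecomposable fun X hX hXY => ?_
    rcases hA.syzygy_iterate n X hX (hXY.trans hY) with hp | hp
    · exact (pd_le_zero_iff.2 hp).trans zero_le
    · exact phi_add_pd_le_psi hp (hXY.pd_le.trans_lt hYtop)
  have h2 := pd_le_of_pd_syzygy_iterate_le n (hYd _ hd)
  have h3 : n ≤ igusaTodorovPsi M := phi_le_psi
  have h4 : igusaTodorovPsi M - n + 1 + n ≤ igusaTodorovPsi M + 1 := by omega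
  exact h2.trans (by exact_mod_cast h4)

end IgusaTodorovInequality

/-! ### Filtrations, pullbacks and pushouts of short exact sequences. -/

section Filtrations

variable {R : Type u} [Ring R]

theorem SES.of_subsingleton_right {A B C : FGModuleCat.{u} R} (h : SES A B C) [Subsingleton C] :
    Nonempty (A ≃ₗ[R] B) := by
  obtain ⟨f, g, h⟩ := h
  exact ⟨LinearEquiv.ofBijective f ⟨h.inj, fun b => (h.exact b).1 (Subsingleton.elim _ _)⟩⟩

theorem SES.of_subsingleton (A : FGModuleCat.{u} R) [Subsingleton A] : SES A A A :=
  ⟨LinearMap.id, LinearMap.id, Function.injective_id,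
    fun x => ⟨fun _ => ⟨x, rfl⟩, fun _ => Subsingleton.elim _ _⟩, Function.surjective_id⟩

theorem SES.prodMap {A B C A' B' C' : FGModuleCat.{u} R} (h : SES A B C) (h' : SES A' B' C') :
    SES (FGModuleCat.of R (A × A')) (FGModuleCat.of R (B × B')) (FGModuleCat.of R (C × C')) := by
  obtain ⟨f, g, h⟩ := h
  obtain ⟨f', g', h'⟩ := h'
  refine ⟨f.prodMap f', g.prodMap g', h.inj.prodMap h'.inj, ?_, h.surj.prodMap h'.surj⟩
  rintro ⟨b, b'⟩
  change ((g b, g' b') : C × C') = 0 ↔ ∃ x : A × A', ((f x.1, f' x.2) : B × B') = (b, b')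
  rw [Prod.mk_eq_zero, h.exact b, h'.exact b']
  constructor
  · rintro ⟨⟨a, rfl⟩, ⟨a', rfl⟩⟩
    exact ⟨(a, a'), rfl⟩
  · rintro ⟨x, hx⟩
    exact ⟨⟨x.1, congrArg Prod.fst hx⟩, ⟨x.2, congrArg Prod.snd hx⟩⟩

/-- The preimage of a submodule of a quotient. -/
theorem SES.exists_pullback [IsNoetherianRing R] {A B D D' X : FGModuleCat.{u} R}
    (h : SES A B D) (h' : SES D' D X) :
    ∃ B' : FGModuleCat.{u} R, SES B' B X ∧ SES A B' D' := by
  obtain ⟨f, g, h⟩ := h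
  obtain ⟨i, p, h'⟩ := h'
  have hs : Function.Surjective (p ∘ₗ g) := h'.surj.comp h.surj
  refine ⟨_, ⟨_, _, isSES_ker hs⟩, ?_⟩
  have e : D' ≃ₗ[R] LinearMap.ker p := (LinearEquiv.ofInjective i h'.inj).trans
    (LinearEquiv.ofEq _ _ (LinearMap.exact_iff.1 h'.exact).symm)
  refine SES.congr (A := A) (C := FGModuleCat.of R (LinearMap.ker p)) ⟨?f, ?g, ?_, ?_, ?_⟩
    (LinearEquiv.refl R A) (LinearEquiv.refl R _) e.symm
  case f =>
    exact LinearMap.codRestrict _ f fun x => by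
      change p (g (f x)) = 0
      rw [h.exact.apply_apply_eq_zero, map_zero]
  case g =>
    exact LinearMap.codRestrict _ (g ∘ₗ (LinearMap.ker (p ∘ₗ g)).subtype) fun x => x.2
  · intro x y hxy
    exact h.inj (congrArg Subtype.val hxy)
  · intro x
    constructor
    · intro hx
      obtain ⟨a, ha⟩ := (h.exact x.1).1 (congrArg Subtype.val hx)
      exact ⟨a, Subtype.ext ha⟩
    · rintro ⟨a, rfl⟩
      exact Subtype.ext (h.exact.apply_apply_eq_zero a)
  · rintro ⟨d, hd⟩
    obtain ⟨b, rfl⟩ := h.surj d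
    exact ⟨⟨b, hd⟩, rfl⟩

/-- The third isomorphism theorem. -/
theorem SES.exists_pushout {A' M' B' M X : FGModuleCat.{u} R}
    (h : SES A' M' B') (h' : SES M' M X) :
    ∃ D : FGModuleCat.{u} R, SES A' M D ∧ SES B' D X := by
  obtain ⟨a, b, h⟩ := h
  obtain ⟨f, g, h'⟩ := h'
  let N := LinearMap.range (f ∘ₗ a)
  have hN : ∀ m, f m ∈ N ↔ b m = 0 := by
    intro m
    rw [h.exact m]
    constructor
    · rintro ⟨x, hx⟩
      exact ⟨x, h'.inj hx⟩
    · rintro ⟨x, rfl⟩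
      exact ⟨x, rfl⟩
  refine ⟨FGModuleCat.of R (M ⧸ N), ⟨f ∘ₗ a, N.mkQ, h'.inj.comp h.inj, ?_, N.mkQ_surjective⟩, ?_⟩
  · exact LinearMap.exact_iff.2 (Submodule.ker_mkQ N)
  let e : (M' ⧸ LinearMap.ker b) ≃ₗ[R] B' := b.quotKerEquivOfSurjective h.surj
  have hk : LinearMap.ker b ≤ LinearMap.ker (N.mkQ ∘ₗ f) := fun m hm => by
    change N.mkQ (f m) = 0
    rw [Submodule.mkQ_apply, Submodule.Quotient.mk_eq_zero]
    exact (hN m).2 hm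
  refine SES.congr (A := FGModuleCat.of R (M' ⧸ LinearMap.ker b))
    ⟨(LinearMap.ker b).liftQ (N.mkQ ∘ₗ f) hk, N.liftQ g ?_, ?_, ?_, ?_⟩
    e (LinearEquiv.refl R _) (LinearEquiv.refl R X)
  · rintro _ ⟨x, rfl⟩
    exact h'.exact.apply_apply_eq_zero _
  · rw [← LinearMap.ker_eq_bot, LinearMap.ker_eq_bot']
    intro x hx
    obtain ⟨m, rfl⟩ := Submodule.mkQ_surjective _ x
    have h1 : N.mkQ (f m) = 0 := hx
    rw [Submodule.mkQ_apply, Submodule.Quotient.mk_eq_zero, hN] at h1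
    rw [Submodule.mkQ_apply, Submodule.Quotient.mk_eq_zero]
    exact h1
  · intro y
    obtain ⟨m, rfl⟩ := N.mkQ_surjective y
    change g m = 0 ↔ _
    constructor
    · intro hm
      obtain ⟨m', rfl⟩ := (h'.exact m).1 hm
      exact ⟨Submodule.Quotient.mk m', rfl⟩
    · rintro ⟨x, hx⟩
      obtain ⟨m', rfl⟩ := Submodule.mkQ_surjective _ x
      have h1 : N.mkQ (f m') = N.mkQ m := hx
      rw [Submodule.mkQ_apply, Submodule.mkQ_apply, Submodule.Quotient.eq] at h1
      obtain ⟨x, hx⟩ := h1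
      have h2 := congrArg g hx
      rw [map_sub, h'.exact.apply_apply_eq_zero, zero_sub] at h2
      have h3 : g (f (a x)) = 0 := h'.exact.apply_apply_eq_zero _
      exact neg_eq_zero.1 (h2.symm.trans h3)
  · intro x
    obtain ⟨m, rfl⟩ := h'.surj x
    exact ⟨N.mkQ m, rfl⟩

/-- Pushout of a short exact sequence. -/
theorem IsSES.exists_pushout {K P M : FGModuleCat.{u} R} {i : K →ₗ[R] P} {p : P →ₗ[R] M}
    (h : IsSES i p) {A : FGModuleCat.{u} R} (a : K →ₗ[R] A) :
    ∃ (E : FGModuleCat.{u} R) (f : A →ₗ[R] E) (g : E →ₗ[R] M) (b : P →ₗ[R] E),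
      IsSES f g ∧ f ∘ₗ a = b ∘ₗ i ∧ g ∘ₗ b = p := by
  -- The pushout is the quotient of `P × A` by the relations `(i k, -a k)`.
  let w : K →ₗ[R] (P × A) := LinearMap.prod i (-a)
  let N := LinearMap.range w
  refine ⟨FGModuleCat.of R ((P × A) ⧸ N), N.mkQ ∘ₗ LinearMap.inr R P A,
    N.liftQ (p ∘ₗ LinearMap.fst R P A) ?_, N.mkQ ∘ₗ LinearMap.inl R P A, ⟨?_, ?_, ?_⟩, ?_, rfl⟩
  · rintro _ ⟨x, rfl⟩
    exact h.exact.apply_apply_eq_zero x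
  · rw [← LinearMap.ker_eq_bot, LinearMap.ker_eq_bot']
    intro y hy
    have h1 : N.mkQ (0, y) = 0 := hy
    rw [Submodule.mkQ_apply, Submodule.Quotient.mk_eq_zero] at h1
    obtain ⟨x, hx⟩ := h1
    have h2 : i x = 0 := congrArg Prod.fst hx
    have h3 : -a x = y := congrArg Prod.snd hx
    rw [← h3, (map_eq_zero_iff i h.inj).1 h2, map_zero, neg_zero]
  · intro z
    obtain ⟨⟨x, y⟩, rfl⟩ := N.mkQ_surjective z
    change p x = 0 ↔ ∃ y', N.mkQ (0, y') = N.mkQ (x, y)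
    constructor
    · intro hx
      obtain ⟨k, rfl⟩ := (h.exact x).1 hx
      refine ⟨y + a k, ?_⟩
      rw [Submodule.mkQ_apply, Submodule.mkQ_apply, Submodule.Quotient.eq]
      exact ⟨-k, Prod.ext (by simp [w]) (by simp [w])⟩
    · rintro ⟨y', hy'⟩
      rw [Submodule.mkQ_apply, Submodule.mkQ_apply, Submodule.Quotient.eq] at hy'
      obtain ⟨k, hk⟩ := hy'
      have h1 : i k = 0 - x := congrArg Prod.fst hk
      have h2 := congrArg p h1
      rwa [h.exact.apply_apply_eq_zero, zero_sub, map_neg, zero_eq_neg] at h2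
  · intro m
    obtain ⟨x, rfl⟩ := h.surj m
    exact ⟨N.mkQ (x, 0), rfl⟩
  · refine LinearMap.ext fun k => ?_
    change N.mkQ (0, a k) = N.mkQ (i k, 0)
    rw [Submodule.mkQ_apply, Submodule.mkQ_apply, Submodule.Quotient.eq]
    exact ⟨-k, Prod.ext (by simp [w]) (by simp [w])⟩

/-- Modules built from the zero module by successive extensions by members of `C`. -/
inductive FiltBy (C : FGModuleCat.{u} R → Prop) : FGModuleCat.{u} R → Prop
  | zero (M : FGModuleCat.{u} R) (h : Subsingleton M) : FiltBy C M
  | step (A B X : FGModuleCat.{u} R) (h : SES A B X) (hA : FiltBy C A) (hX : C X) : FiltBy C B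

variable {C : FGModuleCat.{u} R → Prop}

theorem FiltBy.congr {A B : FGModuleCat.{u} R} (h : FiltBy C A) (e : A ≃ₗ[R] B) : FiltBy C B := by
  cases h with
  | zero _ h => exact .zero _ e.symm.injective.subsingleton
  | step A' _ X h hA hX =>
    exact .step A' B X (h.congr (LinearEquiv.refl R _) e (LinearEquiv.refl R _)) hA hX

theorem FiltBy.mono {C' : FGModuleCat.{u} R → Prop} {A : FGModuleCat.{u} R} (h : FiltBy C A)
    (hC : ∀ X, C X → C' X) : FiltBy C' A := by
  induction h with
  | zero M h => exact .zero M h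
  | step A B X h _ hX ih => exact .step A B X h ih (hC X hX)

theorem filtBy_of_mem {X : FGModuleCat.{u} R} (hX : C X) : FiltBy C X := by
  let Z : FGModuleCat.{u} R := FGModuleCat.of R PUnit.{u + 1}
  have hZ : Subsingleton Z := inferInstanceAs (Subsingleton PUnit)
  refine .step Z X X ((SES.prod Z X).congr (LinearEquiv.refl R _) ?_ (LinearEquiv.refl R _))
    (.zero Z hZ) hX
  exact LinearEquiv.uniqueProd (R := R) (M := X) (M₂ := PUnit.{u + 1})

theorem FiltBy.extension [IsNoetherianRing R] {A B D : FGModuleCat.{u} R} (h : SES A B D)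
    (hA : FiltBy C A) (hD : FiltBy C D) : FiltBy C B := by
  induction hD generalizing A B with
  | zero D hD =>
    obtain ⟨e⟩ := h.of_subsingleton_right
    exact hA.congr e
  | step D' D X h' _ hX ih =>
    obtain ⟨B', hB', hA'⟩ := h.exists_pullback h'
    exact .step B' B X hB' (ih hA' hA) hX

theorem FiltBy.pi [IsNoetherianRing R] {n : ℕ} (M : Fin n → FGModuleCat.{u} R)
    (hM : ∀ i, FiltBy C (M i)) : FiltBy C (FGModuleCat.of R (∀ i, M i)) := by
  induction n with
  | zero => exact .zero _ (inferInstanceAs (Subsingleton (∀ i, M i)))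
  | succ n ih =>
    have h := FiltBy.extension (SES.prod (M 0) (FGModuleCat.of R (∀ i : Fin n, M i.succ))) (hM 0)
      (ih (fun i => M i.succ) fun i => hM i.succ)
    exact h.congr (Fin.consLinearEquiv R fun i => M i)

theorem filtBy_of_isFiltered [IsNoetherianRing R] {M : FGModuleCat.{u} R} (h : IsFiltered C M) :
    FiltBy C M := by
  obtain ⟨m, c, hmono, h0, hm, hc⟩ := h
  have key : ∀ i ≤ m, FiltBy C (FGModuleCat.of R (c i)) := by
    intro i
    induction i with
    | zero =>
      intro _
      refine .zero _ ?_
      change Subsingleton (c 0)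
      rw [h0]
      infer_instance
    | succ i ih =>
      intro hi
      obtain ⟨X, hX, ⟨e⟩⟩ := hc i hi
      let N : Submodule R (FGModuleCat.of R (c (i + 1))) := (c i).submoduleOf (c (i + 1))
      have h : SES (FGModuleCat.of R N) (FGModuleCat.of R (c (i + 1)))
        (FGModuleCat.of R (FGModuleCat.of R (c (i + 1)) ⧸ N)) := ⟨_, _, isSES_submodule N⟩
      exact .step _ _ X (h.congr
        (Submodule.submoduleOfEquivOfLe (hmono (Nat.le_succ i))) (LinearEquiv.refl R _) e)
        (ih (by omega)) hX
  exact (key m le_rfl).congr ((LinearEquiv.ofEq _ _ hm).trans Submodule.topEquiv)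

theorem isFiltered_of_filtBy [IsNoetherianRing R] {M : FGModuleCat.{u} R} (h : FiltBy C M) :
    IsFiltered C M := by
  induction h with
  | zero M h =>
    exact ⟨0, fun _ => ⊥, monotone_const, rfl, Subsingleton.elim _ _, fun i hi => by omega⟩
  | step A B X h _ hX ih =>
    obtain ⟨f, g, h⟩ := h
    obtain ⟨m, c, hmono, h0, hm, hc⟩ := ih
    refine ⟨m + 1, fun i => if i ≤ m then (c i).map f else ⊤, ?_, ?_, ?_, ?_⟩
    · intro i j hij
      by_cases hj : j ≤ m
      · simp only [hj, hij.trans hj, if_true]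
        exact Submodule.map_mono (hmono hij)
      · simp [hj]
    · simp [h0]
    · simp
    · intro i hi
      rcases Nat.lt_or_ge i m with him | him
      · obtain ⟨Y, hY, ⟨e⟩⟩ := hc i him
        -- The two submodules are generalized so that the case distinctions in the chain can be
        -- substituted away inside the dependent quotient.
        have aux : ∀ N N' : Submodule R B, N = (c i).map f → N' = (c (i + 1)).map f →
            Nonempty ((N' ⧸ N.submoduleOf N') ≃ₗ[R] Y) := ?_
        · exact ⟨Y, hY, aux _ _ (if_pos him.le) (if_pos him)⟩
        rintro _ _ rfl rfl
        refine ⟨(Submodule.Quotient.equiv _ _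
          (Submodule.equivMapOfInjective f h.inj (c (i + 1))) ?_).symm.trans e⟩
        ext ⟨x, hx⟩
        simp only [Submodule.submoduleOf, Submodule.mem_map, Submodule.mem_comap,
          Submodule.subtype_apply]
        constructor
        · rintro ⟨y, hy, hxy⟩
          exact ⟨y, hy, congrArg Subtype.val hxy⟩
        · rintro ⟨y, hy, hxy⟩
          exact ⟨⟨y, hmono (Nat.le_succ i) hy⟩, hy, Subtype.ext hxy⟩
      · obtain rfl : i = m := by omega
        have aux : ∀ N N' : Submodule R B, N = (c i).map f → N' = ⊤ →
            Nonempty ((N' ⧸ N.submoduleOf N') ≃ₗ[R] X) := ?_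
        · exact ⟨X, hX, aux _ _ (if_pos le_rfl) (if_neg (by omega))⟩
        rintro _ _ rfl rfl
        let q : (⊤ : Submodule R B) →ₗ[R] X := g ∘ₗ (⊤ : Submodule R B).subtype
        have hq : Function.Surjective q := fun x => by
          obtain ⟨b, rfl⟩ := h.surj x
          exact ⟨⟨b, trivial⟩, rfl⟩
        refine ⟨(Submodule.quotEquivOfEq _ _ ?_).trans (q.quotKerEquivOfSurjective hq)⟩
        ext x
        simp only [Submodule.submoduleOf, hm, Submodule.mem_comap, Submodule.map_top,
          LinearMap.mem_ker]
        exact (h.exact x.1).symm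

end Filtrations

/-! ### Modules filtered by a stratifying system, and their direct summands. -/

section StratifyingSystems

variable {R : Type u} [Ring R] {t : ℕ}

/-- Modules filtered by the `θ i` with `i ∈ S`. -/
def FiltOn (θ : Fin t → FGModuleCat.{u} R) (S : Set (Fin t)) : FGModuleCat.{u} R → Prop :=
  FiltBy fun X => ∃ i ∈ S, X = θ i

variable {θ : Fin t → FGModuleCat.{u} R} {S S' : Set (Fin t)} {M X Y : FGModuleCat.{u} R}

theorem filtOn_univ_iff [IsNoetherianRing R] : FiltOn θ Set.univ M ↔ Filt θ M :=
  ⟨fun h => isFiltered_of_filtBy (FiltBy.mono h fun _ ⟨i, _, hi⟩ => ⟨i, hi⟩),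
    fun h => (filtBy_of_isFiltered h).mono fun _ ⟨i, hi⟩ => ⟨i, trivial, hi⟩⟩

theorem FiltOn.mono (h : FiltOn θ S M) (hS : S ⊆ S') : FiltOn θ S' M :=
  FiltBy.mono h fun _ ⟨i, hi, hX⟩ => ⟨i, hS hi, hX⟩

theorem filtOn_theta {i : Fin t} (hi : i ∈ S) : FiltOn θ S (θ i) :=
  filtBy_of_mem ⟨i, hi, rfl⟩

theorem extOneVanishes_of_subsingleton_right (hY : Subsingleton Y) : ExtOneVanishes X Y := by
  refine extOneVanishes_of_eq_zero fun x => ?_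
  have h : 𝟙 Y.obj = 0 := by
    ext y
    exact Subsingleton.elim (α := Y) _ _
  rw [← Abelian.Ext.comp_mk₀_id x, h, Abelian.Ext.mk₀_zero, Abelian.Ext.comp_zero]

theorem FiltOn.extOneVanishes_right (h : FiltOn θ S Y)
    (hX : ∀ i ∈ S, ExtOneVanishes X (θ i)) : ExtOneVanishes X Y := by
  induction h with
  | zero Y hY => exact extOneVanishes_of_subsingleton_right hY
  | step A B Z h _ hZ ih =>
    obtain ⟨i, hi, rfl⟩ := hZ
    obtain ⟨f, g, h⟩ := h
    exact h.extOneVanishes_mid_right ih (hX i hi)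

theorem FiltOn.extOneVanishes_left (h : FiltOn θ S X)
    (hY : ∀ i ∈ S, ExtOneVanishes (θ i) Y) : ExtOneVanishes X Y := by
  induction h with
  | zero X hX => exact extOneVanishes_of_projective inferInstance
  | step A B Z h _ hZ ih =>
    obtain ⟨i, hi, rfl⟩ := hZ
    obtain ⟨f, g, h⟩ := h
    exact h.extOneVanishes_mid_left ih (hY i hi)

theorem extProj_iff [IsNoetherianRing R] : ExtProj θ X ↔ ∀ i, ExtOneVanishes X (θ i) :=
  ⟨fun h i => h _ (filtOn_univ_iff.1 (filtOn_theta (Set.mem_univ i))),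
    fun h _ hY => (filtOn_univ_iff.2 hY).extOneVanishes_right fun i _ => h i⟩

theorem SES.hom_eq_zero_right {A B D : FGModuleCat.{u} R} (h : SES A B D)
    (hA : ∀ f : X →ₗ[R] A, f = 0) (hD : ∀ f : X →ₗ[R] D, f = 0) (f : X →ₗ[R] B) : f = 0 := by
  obtain ⟨i, p, h⟩ := h
  have h1 : ∀ x, f x ∈ LinearMap.range i := fun x =>
    (h.exact (f x)).1 (LinearMap.congr_fun (hD (p ∘ₗ f)) x)
  let e := LinearEquiv.ofInjective i h.inj
  have h2 := hA (e.symm.toLinearMap ∘ₗ LinearMap.codRestrict _ f h1)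
  refine LinearMap.ext fun x => ?_
  have h3 : e.symm ⟨f x, h1 x⟩ = 0 := LinearMap.congr_fun h2 x
  exact congrArg Subtype.val (e.symm.map_eq_zero_iff.1 h3)

theorem SES.hom_eq_zero_left {A B D : FGModuleCat.{u} R} (h : SES A B D)
    (hA : ∀ f : A →ₗ[R] Y, f = 0) (hD : ∀ f : D →ₗ[R] Y, f = 0) (f : B →ₗ[R] Y) : f = 0 := by
  obtain ⟨i, p, h⟩ := h
  have h1 : LinearMap.ker p ≤ LinearMap.ker f := fun b hb => by
    obtain ⟨a, rfl⟩ := (h.exact b).1 hb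
    exact LinearMap.congr_fun (hA (f ∘ₗ i)) a
  have h2 := hD ((LinearMap.ker p).liftQ f h1 ∘ₗ
    (p.quotKerEquivOfSurjective h.surj).symm.toLinearMap)
  refine LinearMap.ext fun b => ?_
  have h3 := LinearMap.congr_fun h2 (p b)
  have h4 : (p.quotKerEquivOfSurjective h.surj).symm (p b) = Submodule.Quotient.mk b := by
    rw [LinearEquiv.symm_apply_eq]
    rfl
  change (LinearMap.ker p).liftQ f h1 ((p.quotKerEquivOfSurjective h.surj).symm (p b)) = 0 at h3
  rwa [h4] at h3

theorem FiltOn.hom_eq_zero (hX : FiltOn θ S X) (hY : FiltOn θ S' Y)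
    (h : ∀ i ∈ S, ∀ j ∈ S', ∀ f : θ i →ₗ[R] θ j, f = 0) (f : X →ₗ[R] Y) : f = 0 := by
  induction hX with
  | zero X hX => exact Subsingleton.elim _ _
  | step A B Z hs _ hZ ih =>
    obtain ⟨i, hi, rfl⟩ := hZ
    refine hs.hom_eq_zero_left ih (fun g => ?_) f
    clear ih hs f
    induction hY with
    | zero Y hY => exact LinearMap.ext fun x => Subsingleton.elim _ _
    | step A B Z hs _ hZ ih =>
      obtain ⟨j, hj, rfl⟩ := hZ
      exact hs.hom_eq_zero_right ih (h i hi j hj) g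

theorem FiltOn.pd_le (h : FiltOn θ S M) {n : ℕ} (hS : ∀ i ∈ S, pd (θ i) ≤ n) : pd M ≤ n := by
  induction h with
  | zero M h => exact (pd_le_zero_iff.2 inferInstance).trans zero_le
  | step A B Z hs _ hZ ih =>
    obtain ⟨i, hi, rfl⟩ := hZ
    exact hs.pd_mid_le ih (hS i hi)

theorem SES.equiv_prod {A B D : FGModuleCat.{u} R} (h : SES A B D) (hD : ExtOneVanishes D A) :
    Nonempty (B ≃ₗ[R] (A × D)) := by
  obtain ⟨f, g, h⟩ := h
  obtain ⟨l, hl⟩ := h.exists_lift hD LinearMap.id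
  exact h.equiv_of_section hl

/-- The `θ i` with large index can be moved to the bottom of a filtration. -/
theorem FiltOn.exists_split [IsNoetherianRing R] (hθ : IsStratifyingSystem θ) (h : FiltOn θ S M)
    (c : ℕ) : ∃ A B : FGModuleCat.{u} R, SES A M B ∧ FiltOn θ (S ∩ {i | c ≤ i.val}) A ∧
      FiltOn θ (S ∩ {i | i.val < c}) B := by
  induction h with
  | zero M h => exact ⟨M, M, SES.of_subsingleton M, .zero M h, .zero M h⟩
  | step M' M X h _ hX ih =>
    obtain ⟨i, hi, rfl⟩ := hX
    obtain ⟨A', B', hs, hA, hB⟩ := ih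
    obtain ⟨D, hD, hD'⟩ := hs.exists_pushout h
    rcases Nat.lt_or_ge i.val c with hic | hic
    · exact ⟨A', D, hD, hA, .step _ _ _ hD' hB ⟨i, ⟨hi, hic⟩, rfl⟩⟩
    -- For `i ≥ c` the factor `θ i` sits on top of `B'`, whose indices are `< c`; the extension
    -- splits, so `θ i` can be taken as a submodule of `D` and absorbed into the bottom part.
    · obtain ⟨e⟩ := hD'.equiv_prod (hB.extOneVanishes_right fun j hj =>
        hθ.ext_eq_zero j i (Fin.le_def.2 ((show j.val < c from hj.2).le.trans hic)))
      have hD'' : SES (θ i) D B' := (SES.prod (θ i) B').congr (LinearEquiv.refl R _)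
        ((LinearEquiv.prodComm R _ _).trans e.symm) (LinearEquiv.refl R _)
      obtain ⟨A, hA₁, hA₂⟩ := hD.exists_pullback hD''
      exact ⟨A, B', hA₁, .step _ _ _ hA₂ hA ⟨i, ⟨hi, hic⟩, rfl⟩, hB⟩

section

variable [IsArtinianRing R]

/-- When no extensions occur among the factors, every filtration splits, so `M` is a direct sum of
the `θ i` and Krull-Schmidt applies. -/
theorem FiltOn.exists_isRetract (hS : ∀ i ∈ S, ∀ j ∈ S, ExtOneVanishes (θ i) (θ j))
    (h : FiltOn θ S M) (hX : IsIndecomposable X) (hXM : IsRetract X M) :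
    ∃ i ∈ S, IsRetract X (θ i) := by
  induction h with
  | zero M h =>
    exfalso
    obtain ⟨i, p, hp⟩ := hXM
    have := hX.1
    obtain ⟨x, hx⟩ := exists_ne (0 : X)
    apply hx
    rw [show x = p (i x) from (LinearMap.congr_fun hp x).symm, Subsingleton.elim (i x) 0, map_zero]
  | step A B Z h hA hZ ih =>
    obtain ⟨i, hi, rfl⟩ := hZ
    obtain ⟨e⟩ := h.equiv_prod (FiltOn.extOneVanishes_right hA fun j hj => hS i hi j hj)
    rcases hX.isRetract_or (hXM.trans (isRetract_of_equiv (Y := FGModuleCat.of R (_ × _)) e))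
      with h1 | h1
    · exact ih h1
    · exact ⟨i, hi, h1⟩

theorem FiltOn.of_isRetract_of_ext (hθ : IsStratifyingSystem θ)
    (hS : ∀ i ∈ S, ∀ j ∈ S, ExtOneVanishes (θ i) (θ j)) (h : FiltOn θ S M)
    (hXM : IsRetract X M) : FiltOn θ S X := by
  induction X using fg_induction with
  | zero X hX => exact .zero X hX
  | indec X hX =>
    obtain ⟨i, hi, hXi⟩ := h.exists_isRetract hS hX hXM
    obtain ⟨e⟩ := hX.nonempty_equiv (hθ.indecomposable i) hXi
    exact (filtOn_theta hi).congr e.symm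
  | prod A B hA hB =>
    exact FiltBy.extension (SES.prod A B) (hA ((isRetract_prod_left A B).trans hXM))
      (hB ((isRetract_prod_right A B).trans hXM))
  | equiv A B e hA => exact (hA ((isRetract_of_equiv e).trans hXM)).congr e

/-- A retract of the middle term of a short exact sequence `0 → N → M → B → 0` with
`Hom(N, B) = 0` is an extension of retracts. -/
theorem SES.exists_retracts {N B : FGModuleCat.{u} R} (h : SES N M B)
    (h0 : ∀ f : N →ₗ[R] B, f = 0) (hX : IsRetract X M) :
    ∃ N' B' : FGModuleCat.{u} R, SES N' X B' ∧ IsRetract N' N ∧ IsRetract B' B := by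
  obtain ⟨f, g, h⟩ := h
  obtain ⟨i, p, hp⟩ := hX
  have hp' : ∀ x, p (i x) = x := fun x => LinearMap.congr_fun hp x
  let K : Submodule R X := LinearMap.ker (g ∘ₗ i)
  -- As `Hom(N, B) = 0`, the idempotent `i ∘ p` preserves the image of `N`, hence induces
  -- retractions on both ends.
  have hK : ∀ n, p (f n) ∈ K := fun n => LinearMap.congr_fun (h0 (g ∘ₗ i ∘ₗ p ∘ₗ f)) n
  let e := LinearEquiv.ofInjective f h.inj
  have hr : ∀ x : K, i x ∈ LinearMap.range f := fun x => (h.exact (i x)).1 x.2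
  have hker : LinearMap.ker g ≤ LinearMap.ker (K.mkQ ∘ₗ p) := fun m hm => by
    obtain ⟨n, rfl⟩ := (h.exact m).1 hm
    change K.mkQ (p (f n)) = 0
    rw [Submodule.mkQ_apply, Submodule.Quotient.mk_eq_zero]
    exact hK n
  refine ⟨_, _, ⟨_, _, isSES_submodule K⟩,
    ⟨e.symm.toLinearMap ∘ₗ LinearMap.codRestrict _ (i ∘ₗ K.subtype) hr,
      LinearMap.codRestrict K (p ∘ₗ f) hK, ?_⟩,
    ⟨K.liftQ (g ∘ₗ i) le_rfl, (LinearMap.ker g).liftQ (K.mkQ ∘ₗ p) hker ∘ₗ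
      (g.quotKerEquivOfSurjective h.surj).symm.toLinearMap, ?_⟩⟩
  · refine LinearMap.ext fun x => Subtype.ext ?_
    change p (f (e.symm ⟨i x.1, hr x⟩)) = x.1
    have h1 : f (e.symm ⟨i x.1, hr x⟩) = i x.1 := congrArg Subtype.val (e.apply_symm_apply _)
    rw [h1, hp']
  · refine LinearMap.ext fun y => ?_
    obtain ⟨x, rfl⟩ := K.mkQ_surjective y
    change (LinearMap.ker g).liftQ (K.mkQ ∘ₗ p) hker
      ((g.quotKerEquivOfSurjective h.surj).symm (g (i x))) = K.mkQ x
    have h4 : (g.quotKerEquivOfSurjective h.surj).symm (g (i x)) =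
        Submodule.Quotient.mk (i x) := by
      rw [LinearEquiv.symm_apply_eq]
      rfl
    rw [h4]
    change K.mkQ (p (i x)) = _
    rw [hp']

/-- Filtered modules are closed under direct summands. -/
theorem FiltOn.of_isRetract (hθ : IsStratifyingSystem θ) (h : FiltOn θ S M)
    (hXM : IsRetract X M) : FiltOn θ S X := by
  have key : ∀ (c : ℕ) (S : Set (Fin t)) (_ : ∀ i ∈ S, i.val < c) (M X : FGModuleCat.{u} R)
      (_ : FiltOn θ S M) (_ : IsRetract X M), FiltOn θ S X := by
    intro c
    induction c with
    | zero =>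
      intro S hS M X h hXM
      exact h.of_isRetract_of_ext hθ (fun i hi => absurd (hS i hi) (by omega)) hXM
    | succ c ih =>
      intro S hS M X h hXM
      -- Only the index `c` survives in `N`, so `N` is a sum of copies of one `θ i`; `B` is left to
      -- the induction, and there are no maps `N → B`.
      obtain ⟨N, B, hs, hN, hB⟩ := h.exists_split hθ c
      obtain ⟨N', B', hs', hN', hB'⟩ := hs.exists_retracts (fun f =>
        hN.hom_eq_zero hB (fun i hi j hj => hθ.hom_eq_zero j i
          (Fin.lt_def.2 ((show j.val < c from hj.2).trans_le hi.2))) f) hXM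
      refine FiltBy.extension hs' (FiltOn.mono ?_ (Set.inter_subset_left (t := {i | c ≤ i.val})))
        (FiltOn.mono (ih _ (fun i hi => hi.2) B B' hB hB') Set.inter_subset_left)
      refine hN.of_isRetract_of_ext hθ (fun i hi j hj => hθ.ext_eq_zero j i ?_) hN'
      have h1 := hS j hj.1
      have h2 : c ≤ i.val := hi.2
      exact Fin.le_def.2 (by omega)
  exact key t S (fun i _ => i.2) M X h hXM

end

end StratifyingSystems

/-! ### Construction of minimal Ext-projective approximations. -/

section ExtProjectiveCovers

variable {R : Type u} [Ring R] {t : ℕ} {θ : Fin t → FGModuleCat.{u} R}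

/-- Over a finite dimensional algebra, all maps `K → Y` factor through a single map `K → Yⁿ`. -/
theorem exists_universal_map (k : Type*) [Field k] [Algebra k R] [FiniteDimensional k R]
    (K Y : FGModuleCat.{u} R) :
    ∃ (n : ℕ) (a : K →ₗ[R] (Fin n → Y)), ∀ u : K →ₗ[R] Y,
      ∃ v : (Fin n → Y) →ₗ[R] Y, v ∘ₗ a = u := by
  let : Module k K := Module.compHom K (algebraMap k R)
  let : Module k Y := Module.compHom Y (algebraMap k R)
  have : IsScalarTower k R K := ⟨fun c r x => by
    rw [Algebra.smul_def, mul_smul]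
    rfl⟩
  have : IsScalarTower k R Y := ⟨fun c r x => by
    rw [Algebra.smul_def, mul_smul]
    rfl⟩
  have : Module.Finite k K := Module.Finite.trans R K
  have : Module.Finite k Y := Module.Finite.trans R Y
  have : SMulCommClass R k Y := IsScalarTower.to_smulCommClass'
  -- The `R`-linear maps form a subspace of the finite dimensional space of `k`-linear ones; a
  -- spanning family gives the components of `a`.
  have : Module.Finite k (K →ₗ[R] Y) :=
    Module.Finite.of_injective (LinearMap.restrictScalarsₗ k R K Y k)
      (LinearMap.restrictScalars_injective k)
  obtain ⟨n, s, hs⟩ := Module.Finite.exists_fin (R := k) (M := K →ₗ[R] Y)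
  refine ⟨n, LinearMap.pi s, fun u => ?_⟩
  obtain ⟨c, hc⟩ := (Submodule.mem_span_range_iff_exists_fun k).1
    (hs ▸ Submodule.mem_top : u ∈ Submodule.span k (Set.range s))
  refine ⟨∑ i, c i • LinearMap.proj i, ?_⟩
  rw [← hc]
  refine LinearMap.ext fun x => ?_
  simp

/-- Push `0 → ΩM → P → M → 0` out along a universal map from `ΩM` to a power of `θ i`. Every class
in `Ext¹(M, θ i)` then becomes trivial on `E`, and no new class arises as `θ i` has no
self-extensions. -/
theorem exists_universal_extension (k : Type*) [Field k] [Algebra k R] [FiniteDimensional k R]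
    [IsArtinianRing R] (M : FGModuleCat.{u} R) (i : Fin t) (hi : ExtOneVanishes (θ i) (θ i)) :
    ∃ K E : FGModuleCat.{u} R, SES K E M ∧ FiltOn θ {i} K ∧ ExtOneVanishes E (θ i) := by
  have hs := isSES_ker (isProjCover_projCoverMap M).surjective
  obtain ⟨n, a, ha⟩ := exists_universal_map k (syzygy M) (θ i)
  obtain ⟨E, f, g, b, hE, hab, hb⟩ := hs.exists_pushout (A := FGModuleCat.of R (Fin n → θ i)) a
  have hK : FiltOn θ {i} (FGModuleCat.of R (Fin n → θ i)) :=
    FiltBy.pi (fun _ => θ i) fun _ => filtOn_theta rfl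
  refine ⟨_, E, ⟨f, g, hE⟩, hK, ?_⟩
  refine hE.extOneVanishes_pushout hs (projective_projCover M) a b LinearMap.id hab hb
    Function.bijective_id (hK.extOneVanishes_left ?_) ha
  rintro _ rfl
  exact hi

/-- Universal extensions by `θ d` are made for increasing `d ≥ c`. Since `Ext¹(θ d, θ j) = 0` for `j
≤ d`, a later extension does not undo the vanishing already achieved. -/
theorem exists_approximation (k : Type*) [Field k] [Algebra k R] [FiniteDimensional k R]
    [IsArtinianRing R] (hθ : IsStratifyingSystem θ) (M : FGModuleCat.{u} R) (c : ℕ)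
    (hc : ∀ j : Fin t, j.val < c → ExtOneVanishes M (θ j)) :
    ∃ K Q : FGModuleCat.{u} R, SES K Q M ∧ FiltOn θ {i | c ≤ i.val} K ∧
      ∀ j, ExtOneVanishes Q (θ j) := by
  have key : ∀ d, c ≤ d → ∃ K Q : FGModuleCat.{u} R, SES K Q M ∧
      FiltOn θ {i | c ≤ i.val} K ∧ ∀ j : Fin t, j.val < d → ExtOneVanishes Q (θ j) := by
    intro d hd
    induction d, hd using Nat.le_induction with
    | base =>
      let Z : FGModuleCat.{u} R := FGModuleCat.of R PUnit.{u + 1}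
      have hZ : Subsingleton Z := inferInstanceAs (Subsingleton PUnit)
      exact ⟨Z, M, (SES.prod Z M).congr (LinearEquiv.refl R _)
        (LinearEquiv.uniqueProd (R := R) (M := M) (M₂ := PUnit.{u + 1})) (LinearEquiv.refl R _),
        .zero Z hZ, hc⟩
    | succ d hd ih =>
      obtain ⟨K, Q, hs, hK, hQ⟩ := ih
      by_cases hdt : d < t
      · obtain ⟨K₁, E, hE, hK₁, hEd⟩ := exists_universal_extension k Q (⟨d, hdt⟩ : Fin t)
          (hθ.ext_eq_zero _ _ le_rfl)
        obtain ⟨K', hK', hK''⟩ := hE.exists_pullback hs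
        refine ⟨K', E, hK', FiltBy.extension hK'' (FiltOn.mono hK₁ ?_) hK, fun j hj => ?_⟩
        · rintro _ rfl
          exact hd
        rcases Nat.lt_succ_iff_lt_or_eq.1 hj with h | h
        · obtain ⟨f, g, hE⟩ := hE
          refine hE.extOneVanishes_mid_left (hK₁.extOneVanishes_left ?_) (hQ j h)
          rintro _ rfl
          exact hθ.ext_eq_zero _ _ (Fin.le_def.2 h.le)
        · obtain rfl : j = ⟨d, hdt⟩ := Fin.ext h
          exact hEd
      · exact ⟨K, Q, hs, hK, fun j _ => hQ j (by omega)⟩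
  obtain ⟨K, Q, hs, hK, hQ⟩ := key (max c t) (le_max_left c t)
  exact ⟨K, Q, hs, hK, fun j => hQ j (lt_of_lt_of_le j.2 (le_max_right c t))⟩

/-- Take `Q` of least length. If `f ∘ h = f`, then `f` kills the part of `Q` on which `h` is
nilpotent, and the complement is again an approximation; so that part is zero. -/
theorem exists_minimal_approximation (k : Type*) [Field k] [Algebra k R] [FiniteDimensional k R]
    [IsArtinianRing R] (hθ : IsStratifyingSystem θ) (M : FGModuleCat.{u} R) (c : ℕ)
    (hc : ∀ j : Fin t, j.val < c → ExtOneVanishes M (θ j)) :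
    ∃ (K Q : FGModuleCat.{u} R) (i : K →ₗ[R] Q) (f : Q →ₗ[R] M), IsSES i f ∧
      FiltOn θ {i | c ≤ i.val} K ∧ (∀ j, ExtOneVanishes Q (θ j)) ∧
      ∀ g : Q →ₗ[R] Q, f ∘ₗ g = f → Function.Bijective g := by
  let L : Set ℕ∞ := {l | ∃ (K Q : FGModuleCat.{u} R) (i : K →ₗ[R] Q) (f : Q →ₗ[R] M),
    IsSES i f ∧ FiltOn θ {i | c ≤ i.val} K ∧ (∀ j, ExtOneVanishes Q (θ j)) ∧
      l = Module.length R Q}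
  have hL : L.Nonempty := by
    obtain ⟨K, Q, ⟨i, f, hs⟩, hK, hQ⟩ := exists_approximation k hθ M c hc
    exact ⟨_, K, Q, i, f, hs, hK, hQ, rfl⟩
  obtain ⟨K, Q, i, f, hs, hK, hQ, hl⟩ := csInf_mem hL
  refine ⟨K, Q, i, f, hs, hK, hQ, fun h hh => ?_⟩
  obtain ⟨n, Y, j, p, q, hn, hpj, hhj, hq₁, hq₂⟩ := exists_fitting (h : Module.End R Q)
  have hpj' : ∀ y, p (j y) = y := fun y => LinearMap.congr_fun hpj y
  have hfh : ∀ m : ℕ, f ∘ₗ ((h : Module.End R Q) ^ m : Module.End R Q) = f := by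
    intro m
    induction m with
    | zero => rfl
    | succ m ih => rw [pow_succ, Module.End.mul_eq_comp, ← LinearMap.comp_assoc, ih, hh]
  have hfj : ∀ y, f (j y) = 0 := fun y => by
    have h1 := LinearMap.congr_fun (hfh n) (j y)
    have h2 : ((h : Module.End R Q) ^ n : Module.End R Q) (j y) = 0 := LinearMap.congr_fun hhj y
    rw [← h1, LinearMap.comp_apply, h2, map_zero]
  let I : FGModuleCat.{u} R := FGModuleCat.of R (LinearMap.ker p)
  let r : Q →ₗ[R] I := LinearMap.codRestrict (LinearMap.ker p) (LinearMap.id - j ∘ₗ p) fun x => by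
    simp [hpj']
  have hr : ∀ x, (r x : Q) = x - j (p x) := fun x => rfl
  have hrI : ∀ x : I, r x.1 = x := fun x => Subtype.ext (by
    rw [hr, LinearMap.mem_ker.1 x.2, map_zero, sub_zero])
  let f' : I →ₗ[R] M := f ∘ₗ (LinearMap.ker p).subtype
  have hfr : ∀ x, f' (r x) = f x := fun x => by
    change f (r x : Q) = f x
    rw [hr, map_sub, hfj, sub_zero]
  have hf' : Function.Surjective f' := fun m => by
    obtain ⟨x, rfl⟩ := hs.surj m
    exact ⟨r x, hfr x⟩
  have hIQ : IsRetract I Q := ⟨(LinearMap.ker p).subtype, r, LinearMap.ext hrI⟩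
  -- The new kernel is a summand of the old one, hence still filtered by `FiltOn.of_isRetract`.
  have hker : IsRetract (FGModuleCat.of R (LinearMap.ker f'))
      (FGModuleCat.of R (LinearMap.ker f)) :=
    ⟨LinearMap.codRestrict _ ((LinearMap.ker p).subtype ∘ₗ (LinearMap.ker f').subtype) fun x => x.2,
      LinearMap.codRestrict _ (r ∘ₗ (LinearMap.ker f).subtype) fun x =>
        (hfr x.1).trans x.2, LinearMap.ext fun x => Subtype.ext (hrI x.1)⟩
  have hKf : IsRetract (FGModuleCat.of R (LinearMap.ker f)) K :=
    isRetract_of_equiv ((LinearEquiv.ofEq _ _ (LinearMap.exact_iff.1 hs.exact)).trans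
      (LinearEquiv.ofInjective i hs.inj).symm)
  have hle : Module.length R Q ≤ Module.length R I := by
    rw [← hl]
    exact csInf_le' ⟨_, I, _, f', isSES_ker hf', hK.of_isRetract hθ (hker.trans hKf),
      fun j => hIQ.extOneVanishes_left (hQ j), rfl⟩
  have htop : LinearMap.ker p = ⊤ := by
    by_contra hne
    exact absurd hle (not_le.2 (Submodule.length_lt hne))
  have hp : p = 0 := LinearMap.ker_eq_top.1 htop
  rw [hp, LinearMap.comp_zero, zero_add] at hq₁ hq₂
  have hu : IsUnit ((h : Module.End R Q) ^ n : Module.End R Q) := ⟨⟨_, q, hq₂, hq₁⟩, rfl⟩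
  exact (Module.End.isUnit_iff _).1 ((isUnit_pow_iff (by omega)).1 hu)

end ExtProjectiveCovers

/-! ### Ext-projective covers and the bound on the finitistic dimension. -/

section FinitisticDimension

variable {R : Type u} [Ring R] [IsArtinianRing R] {t : ℕ} {θ : Fin t → FGModuleCat.{u} R}

theorem exists_isExtProjCover (k : Type*) [Field k] [Algebra k R] [FiniteDimensional k R]
    (hθ : IsStratifyingSystem θ) {M : FGModuleCat.{u} R} (hM : Filt θ M) :
    ∃ (Q : FGModuleCat.{u} R) (f : Q →ₗ[R] M), IsExtProjCover θ f := by
  obtain ⟨K, Q, i, f, hs, hK, hQ, hmin⟩ :=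
    exists_minimal_approximation k hθ M 0 fun j hj => absurd hj (by omega)
  have hK' : FiltOn θ Set.univ K := hK.mono (Set.subset_univ _)
  refine ⟨Q, f, ⟨filtOn_univ_iff.1 (FiltBy.extension ⟨i, f, hs⟩ hK' (filtOn_univ_iff.2 hM)), hM,
    extProj_iff.2 hQ, fun X hX g => hs.exists_lift (hX K (filtOn_univ_iff.1 hK')) g, hmin,
    filtOn_univ_iff.1 (FiltBy.congr hK' ?_)⟩⟩
  exact (LinearEquiv.ofInjective i hs.inj).trans
    (LinearEquiv.ofEq _ _ (LinearMap.exact_iff.1 hs.exact).symm)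

/-- The minimal approximation of `θ a` is a direct summand of every Ext-projective cover of the
direct sum of the `θ i`. -/
theorem IsExtProjCover.exists_approximation (k : Type*) [Field k] [Algebra k R]
    [FiniteDimensional k R] (hθ : IsStratifyingSystem θ) {Q : FGModuleCat.{u} R}
    {f : Q →ₗ[R] FGModuleCat.of R (∀ i, θ i)} (hf : IsExtProjCover θ f) (a : Fin t) :
    ∃ K Q' : FGModuleCat.{u} R, SES K Q' (θ a) ∧ FiltOn θ {i | a < i} K ∧
      (∀ j, ExtOneVanishes Q' (θ j)) ∧ IsRetract Q' Q := by
  -- Starting at `a + 1` is allowed because `Ext¹(θ a, θ j) = 0` for `j ≤ a`; this keeps `θ a` out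
  -- of the kernel `K`.
  obtain ⟨K, Q', i, f', hs, hK, hQ', hmin⟩ :=
    exists_minimal_approximation k hθ (θ a) (a.val + 1) fun j hj =>
      hθ.ext_eq_zero j a (Fin.le_def.2 (Nat.lt_succ_iff.1 hj))
  obtain ⟨h, hh⟩ := hf.approx Q' (extProj_iff.2 hQ') (LinearMap.single R (fun i => θ i) a ∘ₗ f')
  obtain ⟨g, hg⟩ := hs.exists_lift
    (hf.source_extProj K (filtOn_univ_iff.1 (hK.mono (Set.subset_univ _))))
    (LinearMap.proj a ∘ₗ f)
  -- The maps `h : Q' → Q` and `g : Q → Q'` lie over the inclusion and projection of `θ a`, so `f' ∘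
  -- g ∘ h = f'` and minimality makes `g ∘ h` invertible.
  refine ⟨K, Q', ⟨i, f', hs⟩, hK, hQ', isRetract_of_isUnit (i := h) (p := g) ?_⟩
  refine (Module.End.isUnit_iff _).2 (hmin (g ∘ₗ h) (LinearMap.ext fun x => ?_))
  have h1 : f' (g (h x)) = f (h x) a := LinearMap.congr_fun hg (h x)
  have h2 : f (h x) = Pi.single a (f' x) := LinearMap.congr_fun hh x
  change f' (g (h x)) = f' x
  rw [h1, h2, Pi.single_eq_same]

/-- `T` is a direct sum of copies of `θ a`, so the same number of copies of the approximation of `θ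
a` serves. -/
theorem exists_cover_of_filtOn_singleton (hθ : IsStratifyingSystem θ) {a : Fin t}
    {K₀ Q₀ T : FGModuleCat.{u} R}
    (h₀ : SES K₀ Q₀ (θ a)) (hK₀ : FiltOn θ {i | a < i} K₀) (hQ₀ : ∀ j, ExtOneVanishes Q₀ (θ j))
    (hT : FiltOn θ {a} T) :
    ∃ K Q : FGModuleCat.{u} R, SES K Q T ∧ FiltOn θ {i | a < i} K ∧
      (∀ j, ExtOneVanishes Q (θ j)) ∧ IsAddProj Q Q₀ := by
  induction hT with
  | zero T hT =>
    exact ⟨T, T, SES.of_subsingleton T, .zero T hT,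
      fun j => extOneVanishes_of_projective inferInstance,
      isAddProj_of_projective inferInstance⟩
  | step T' T X h hT' hX ih =>
    obtain ⟨_, rfl, rfl⟩ := hX
    rename_i a
    obtain ⟨K, Q, hs, hK, hQ, hadd⟩ := ih
    obtain ⟨e⟩ := h.equiv_prod (FiltOn.extOneVanishes_right (S := {a}) hT'
      (by rintro _ rfl; exact hθ.ext_eq_zero _ _ le_rfl))
    refine ⟨_, _, (hs.prodMap h₀).congr (LinearEquiv.refl R _) (LinearEquiv.refl R _) e.symm,
      FiltBy.extension (SES.prod K K₀) hK hK₀,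
      fun j => (isSES_prod Q Q₀).extOneVanishes_mid_left (hQ j) (hQ₀ j),
      hadd.prod (IsRetract.refl Q₀).isAddProj⟩

theorem FiltOn.isAddProj (hθ : IsStratifyingSystem θ) {b : Fin t} {N : FGModuleCat.{u} R}
    (hN : FiltOn θ {b} N) : IsAddProj N (θ b) := fun X hX hXN => by
  obtain ⟨_, rfl, h⟩ := hN.exists_isRetract
    (by rintro _ rfl _ rfl; exact hθ.ext_eq_zero _ _ le_rfl) hX hXN
  exact .inr h

/-- Cut `N` below and above `b`. The outer pieces have projective dimension at most `s` and
disappear stably under `Ω^(s+1)`, leaving a direct sum of copies of `θ b`. -/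
theorem FiltOn.isAddProj_syzygy (hθ : IsStratifyingSystem θ) {b : Fin t} {S : Set (Fin t)} {s : ℕ}
    (hS : ∀ i ∈ S, i ≠ b → pd (θ i) ≤ s) {N : FGModuleCat.{u} R} (hN : FiltOn θ S N) :
    IsAddProj (syzygy^[s + 1] N) (syzygy^[s + 1] (θ b)) := by
  obtain ⟨N₁, N₂, h₁, hN₁, hN₂⟩ := hN.exists_split hθ b.val
  obtain ⟨N₃, N₄, h₂, hN₃, hN₄⟩ := hN₁.exists_split hθ (b.val + 1)
  have e₁ := h₁.kClass_syzygy_of_pd_right_le (hN₂.pd_le fun i hi => hS i hi.1 (by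
    rintro rfl
    exact lt_irrefl _ (show i.val < i.val from hi.2)))
  have e₂ := h₂.kClass_syzygy_of_pd_left_le (hN₃.pd_le fun i hi => hS i hi.1.1 (by
    rintro rfl
    exact lt_irrefl _ (show i.val < i.val from hi.2)))
  have hN₄' : FiltOn θ {b} N₄ := hN₄.mono fun i hi => by
    have h3 : b.val ≤ i.val := hi.1.2
    have h4 : i.val < b.val + 1 := hi.2
    exact Fin.ext (by omega)
  exact ((hN₄'.isAddProj hθ).syzygy_iterate (s + 1)).of_kClass_eq (e₁.trans e₂).symm

theorem IsAddProj.prod_syzygy_iterate {A B M : FGModuleCat.{u} R} {n : ℕ}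
    (hA : IsAddProj (syzygy^[n] A) M) (hB : IsAddProj (syzygy^[n] B) M) :
    IsAddProj (syzygy^[n] (FGModuleCat.of R (A × B))) M := by
  obtain ⟨e⟩ := syzygy_iterate_prod n A B
  exact (hA.prod hB).of_isRetract (isRetract_of_equiv (Y := FGModuleCat.of R (_ × _)) e)

/-- The Igusa-Todorov inequality after passing to syzygies. -/
theorem SES.pd_syzygy_le_psi {A B C M : FGModuleCat.{u} R} (h : SES A B C) (n : ℕ)
    (hA : IsAddProj (syzygy^[n] A) M) (hB : IsAddProj (syzygy^[n] B) M)
    (hC : pd (syzygy^[n] C) < ⊤) : pd (syzygy^[n] C) ≤ (igusaTodorovPsi M + 1 : ℕ) := by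
  obtain ⟨B', hB', h'⟩ := h.horseshoe_iterate n
  exact h'.pd_le_psi hA (hB.of_kClass_eq hB'.symm) hC

/-- Filtered modules of finite projective dimension, for a stratifying system with two members of
infinite projective dimension. -/
theorem pd_le_of_filt (k : Type*) [Field k] [Algebra k R] [FiniteDimensional k R]
    (hθ : IsStratifyingSystem θ) {a b : Fin t} (hab : a < b) {s : ℕ}
    (hs : ∀ i, i ≠ a → i ≠ b → pd (θ i) ≤ s) {Q : FGModuleCat.{u} R}
    {f : Q →ₗ[R] FGModuleCat.of R (∀ i, θ i)} (hf : IsExtProjCover θ f) {M : FGModuleCat.{u} R}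
    (hM : Filt θ M) (hpd : pd M < ⊤) :
    pd M ≤ (s + 2 + igusaTodorovPsi
      (FGModuleCat.of R ((syzygy^[s + 1] (θ b)) × (syzygy^[s + 2] (θ a)))) : ℕ) ∧
    pd M ≤ (s + 2 + igusaTodorovPsi
      (syzygy^[s + 1] (FGModuleCat.of R (Q × θ b))) : ℕ) := by
  obtain ⟨N, D, h₁, hN, hD⟩ := (filtOn_univ_iff.2 hM).exists_split hθ a.val
  obtain ⟨X, T, h₂, hX, hT⟩ := hN.exists_split hθ (a.val + 1)
  have hX' : FiltOn θ {i | a < i} X := hX.mono fun i hi => Fin.lt_def.2 (Nat.lt_of_succ_le hi.2)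
  have hT' : FiltOn θ {a} T := hT.mono fun i hi => by
    have h3 : a.val ≤ i.val := hi.1.2
    have h4 : i.val < a.val + 1 := hi.2
    exact Fin.ext (by omega)
  have hab' : a.val < b.val := hab
  have hMN := h₁.kClass_syzygy_of_pd_right_le (s := s) (hD.pd_le fun i hi => hs i
    (by rintro rfl; exact lt_irrefl _ (show i.val < i.val from hi.2))
    (by rintro rfl; exact lt_asymm hab' (show i.val < a.val from hi.2)))
  have hNpd : pd (syzygy^[s + 1] N) < ⊤ :=
    pd_lt_top_of_kClass_eq hMN (pd_syzygy_iterate_lt_top (s + 1) hpd)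
  -- In `s + 2`, the `s + 1` counts syzygies and the last unit is the one in the Igusa-Todorov
  -- inequality.
  have hbound : ∀ n : ℕ, pd (syzygy^[s + 1] N) ≤ (n + 1 : ℕ) → pd M ≤ (s + 2 + n : ℕ) := by
    intro n hn
    have := pd_le_of_pd_syzygy_iterate_le (s + 1) (pd_le_of_kClass_eq hMN.symm hn)
    rwa [show n + 1 + (s + 1) = s + 2 + n by omega] at this
  have hlarge : ∀ i ∈ {i | a < i}, i ≠ b → pd (θ i) ≤ s := fun i hi hib =>
    hs i (ne_of_gt hi) hib
  have hXadd := hX'.isAddProj_syzygy hθ hlarge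
  constructor
  -- First bound: the sequence `0 → ΩT → X ⊕ P → N → 0`; the syzygy of `T` accounts for the exponent
  -- `s + 2` at `θ a`.
  · refine hbound _ (h₂.rotate.pd_syzygy_le_psi (s + 1) ?_ ?_ hNpd)
    · have h5 := (hT'.isAddProj hθ).syzygy_iterate (s + 2)
      rw [Function.iterate_succ_apply] at h5
      exact h5.mono (isRetract_prod_right _ _)
    · exact (hXadd.mono (isRetract_prod_left _ _)).prod_syzygy_iterate
        (isAddProj_of_projective
          (projective_syzygy_iterate_of_projective (projective_projCover T) _))
  · obtain ⟨K₀, Q₀, h₀, hK₀, hQ₀, hret⟩ := hf.exists_approximation k hθ a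
    obtain ⟨K, Q', ⟨i, p, h₃⟩, hK, hQ', hadd⟩ := exists_cover_of_filtOn_singleton hθ h₀ hK₀ hQ₀ hT'
    obtain ⟨u, v, h₂⟩ := h₂
    -- Second bound: `Ext¹(Q', X) = 0` lifts `Q' → T` to `N`, giving `0 → K → X ⊕ Q' → N → 0`.
    obtain ⟨l, hl⟩ := h₂.exists_lift (hX'.extOneVanishes_right fun j _ => hQ' j) p
    have hb := (isRetract_prod_right Q (θ b)).syzygy_iterate (s + 1)
    refine hbound _ ((h₂.ses_of_lift h₃ hl).pd_syzygy_le_psi (s + 1)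
      ((hK.isAddProj_syzygy hθ hlarge).mono hb)
      ((hXadd.mono hb).prod_syzygy_iterate ?_) hNpd)
    exact (hadd.mono (hret.trans (isRetract_prod_left Q (θ b)))).syzygy_iterate (s + 1)

end FinitisticDimension

end StratSys

open StratSys
theorem theorem4p7 {k : Type*} [Field k] [IsAlgClosed k] {R : Type u} [Ring R] [Algebra k R]
    [FiniteDimensional k R] {t : ℕ} (θ : Fin t → FGModuleCat.{u} R) (hθ : IsStratifyingSystem θ)
    (i₀ i₁ : Fin t) (h01 : i₀ < i₁) (hinf : {i | pd (θ i) = ⊤} = {i₀, i₁})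
    (s : ℕ) (hs : (s : ℕ∞) = (Finset.univ.filter fun j => j ≠ i₀ ∧ j ≠ i₁).sup fun j => pd (θ j)) :
    haveI : IsArtinianRing R := IsArtinianRing.of_finite k R
    let α : ℕ := igusaTodorovPsi
      (FGModuleCat.of R ((syzygy^[s + 1] (θ i₁)) × (syzygy^[s + 2] (θ i₀))))
    let β : FGModuleCat.{u} R → ℕ := fun Q =>
      igusaTodorovPsi (syzygy^[s + 1] (FGModuleCat.of R (Q × θ i₁)))
    -- the Ext-projective cover of the direct sum of the `θ i` exists, and for any choice of it
    -- (it is unique up to isomorphism) the bound holds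
    (∃ (Q : FGModuleCat.{u} R) (f : Q →ₗ[R] FGModuleCat.of R (∀ i, θ i)), IsExtProjCover θ f) ∧
    ∀ (Q : FGModuleCat.{u} R) (f : Q →ₗ[R] FGModuleCat.of R (∀ i, θ i)), IsExtProjCover θ f →
      pfd (Filt θ) ≤ ((s + 2 + min α (β Q) : ℕ) : ℕ∞) := by
  have : IsArtinianRing R := IsArtinianRing.of_finite k R
  intro α β
  refine ⟨exists_isExtProjCover k hθ (filtOn_univ_iff.1 (FiltBy.pi θ fun i =>
    filtOn_theta (Set.mem_univ i))), fun Q f hf => iSup₂_le fun M hM => ?_⟩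
  -- For `t = 2` the supremum in `hs` is empty and equals `0`, matching the convention for `s`.
  have hs' : ∀ i, i ≠ i₀ → i ≠ i₁ → pd (θ i) ≤ s := fun i h0 h1 => by
    rw [hs]
    exact Finset.le_sup (f := fun j => pd (θ j)) (Finset.mem_filter.2 ⟨Finset.mem_univ i, h0, h1⟩)
  obtain ⟨h1, h2⟩ := pd_le_of_filt k hθ h01 hs' hf hM.1 hM.2
  rcases le_total α (β Q) with h | h
  · rw [min_eq_left h]
    exact h1
  · rw [min_eq_right h]
    exact h2
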